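/- Setting. Let $n\ge 0$ and, for $j\in[n]$, let $(\Omega_j,\Sigma_j,\mu_j)$ be a $\sigma$-finite measure space and $\varphi_{0j},\varphi_{1j}$ two probability densities with respect to $\mu_j$ (probability mass functions if $\mu_j$ is a counting measure). On the product space $\Omega=\prod_j\Omega_j$ with $\mu=\bigotimes_j\mu_j$ put $\varphi_z(x)=\prod_{j}\varphi_{zj}(x_j)$, $z\in\{0,1\}$, and assume that both Kullback–Leibler divergences between the distributions with densities $\varphi_0$ and $\varphi_1$ are positive real numbers. For $\alpha\in(0,1)$ let $$C_\alpha(\varphi_0,\varphi_1)=-\log\int_\Omega\varphi_0^{1-\alpha}\varphi_1^{\alpha}\,d\mu,\qquad \varphi_\alpha=\varphi_0^{1-\alpha}\varphi_1^{\alpha}e^{C_\alpha(\varphi_0,\varphi_1)},$$ and define $\varphi_{\alpha j}$ in the same way from $\varphi_{0j},\varphi_{1j}$. Let $\alpha^*=\arg\max_{\alpha\in(0,1)}C_\alpha(\varphi_0,\varphi_1)$, let $Y=(Y_1,\dots,Y_n)\sim\varphi_{\alpha^*}$, so that the $Y_j\sim\varphi_{\alpha^*j}$ are independent, and put $$Z_j=\log\frac{\varphi_{0j}}{\varphi_{1j}}(Y_j)-\mathbb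 E\Big[\log\frac{\varphi_{0j}}{\varphi_{1j}}(Y_j)\Big],\qquad \bar\sigma_n=\Big(\frac1n\sum_{j=1}^n\mathrm{Var}[Z_j]\Big)^{1/2},$$ $$\eta(\varphi_0,\varphi_1)=\int_\Omega\min(\varphi_0,\varphi_1)\,d\mu,\qquad g_\alpha(x)=\exp\big[\min(\alpha x,(\alpha-1)x)\big].$$ Exponential families. For $j\in[n]$ consider an exponential family of densities $h_j(x)\exp[\theta^\top T_j(x)-A_j(\theta)]$ with respect to $\mu_j$, with parameter $\theta$ in a convex set $\Theta_j\subseteq\mathbb R^d$, $h_j\ge 0$, and log-partition function $A_j$ smooth on $\Theta_j$ (if $\Theta_j$ is not open: $A_j$ is given with an extension that is smooth at every point of $\Theta_j$). One family common to all $j$ is a special case. Statement. For every $C_1$ there are positive constants $C_2,C_3,C_4$ depending only on $C_1$ such that the following holds for all data as above. The maximizer $\alpha^*\in(0,1)$ exists and is unique, and $\bar\sigma_n>0$. (i) General densities. If $\sum_{j}\mathbb E|Z_j|^3\le C_1n\bar\sigma_n^2$, then $$\mathbb E\Big[g_{\alpha^*}\Big(\log\frac{\varphi_0}{\varphi_1}(Y)\Big)\Big]\le\frac{C_2}{\sqrt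 n\,\bar\sigma_n(1-\alpha^*)\alpha^*},\qquad \eta(\varphi_0,\varphi_1)\le\frac{C_2}{\sqrt n\,\bar\sigma_n(1-\alpha^*)\alpha^*}\,e^{-C_{\alpha^*}(\varphi_0,\varphi_1)},$$ and if moreover $\sqrt n\,\bar\sigma_n(1-\alpha^*)\alpha^*\ge C_3$, then both reverse inequalities hold with $C_4$ in place of $C_2$. (ii) Exponential families. Suppose that $\varphi_{zj}(x)=h_j(x)\exp[\theta_{zj}^\top T_j(x)-A_j(\theta_{zj})]$ with $\theta_{zj}\in\Theta_j$ for $z\in\{0,1\}$ and $j\in[n]$, and put $\theta_{\alpha j}=(1-\alpha)\theta_{0j}+\alpha\theta_{1j}$. Then $$\mathrm{Var}[Z_j]=(\theta_{0j}-\theta_{1j})^\top\mathrm{Hess}A_j(\theta_{\alpha^*j})(\theta_{0j}-\theta_{1j})\ \ (j\in[n]),\qquad \bar\sigma_n^2=\frac1n\sum_{j=1}^n(\theta_{0j}-\theta_{1j})^\top\mathrm{Hess}A_j(\theta_{\alpha^*j})(\theta_{0j}-\theta_{1j}),$$ $$C_{\alpha^*}(\varphi_0,\varphi_1)=\sum_{j=1}^n\big[(1-\alpha^*)A_j(\theta_{0j})+\alpha^*A_j(\theta_{1j})-A_j(\theta_{\alpha^*j})\big].$$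 If $\sum_{j}\mathbb E|Z_j|^3\le C_1n\bar\sigma_n^2$, then, with the same constants, $$\eta(\varphi_0,\varphi_1)\le\frac{C_2}{\sqrt n\,\bar\sigma_n(1-\alpha^*)\alpha^*}\exp\Big(-\sum_{j=1}^n\big[(1-\alpha^*)A_j(\theta_{0j})+\alpha^*A_j(\theta_{1j})-A_j(\theta_{\alpha^*j})\big]\Big),$$ and if moreover $\sqrt n\,\bar\sigma_n(1-\alpha^*)\alpha^*\ge C_3$, then $$\eta(\varphi_0,\varphi_1)\ge\frac{C_4}{\sqrt n\,\bar\sigma_n(1-\alpha^*)\alpha^*}\exp\Big(-\sum_{j=1}^n\big[(1-\alpha^*)A_j(\theta_{0j})+\alpha^*A_j(\theta_{1j})-A_j(\theta_{\alpha^*j})\big]\Big).$$ -/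

import Mathlib

open MeasureTheory ProbabilityTheory
open scoped ENNReal ContDiff

universe u

noncomputable section

/-- `f` is a probability density function with respect to `ν` (a probability mass function if `ν`
is a counting measure). -/
structure IsDensity {X : Type u} [MeasurableSpace X] (ν : Measure X) (f : X → ℝ) : Prop where
  measurable : Measurable f
  nonneg : ∀ x, 0 ≤ f x
  integral_eq_one : ∫ x, f x ∂ν = 1

/-- The probability measure with density `f` with respect to `ν`. -/
def densityMeasure {X : Type u} [MeasurableSpace X] (ν : Measure X) (f : X → ℝ) : Measure X :=
  ν.withDensity fun x => ENNReal.ofReal (f x)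

/-- The product density `φ(x₁, …, xₙ) = ∏ⱼ φⱼ(xⱼ)` on the product space. -/
def prodDensity {n : ℕ} {Ω : Fin n → Type u} (φ : ∀ j, Ω j → ℝ) (x : ∀ j, Ω j) : ℝ :=
  ∏ j, φ j (x j)

/-- The class of pairs of product densities whose two Kullback-Leibler divergences are positive
real numbers. -/
structure IsTestingPair {n : ℕ} {Ω : Fin n → Type u} [∀ j, MeasurableSpace (Ω j)]
    (μ : ∀ j, Measure (Ω j)) [∀ j, SigmaFinite (μ j)] (φ₀ φ₁ : ∀ j, Ω j → ℝ) : Prop where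
  density_zero : ∀ j, IsDensity (μ j) (φ₀ j)
  density_one : ∀ j, IsDensity (μ j) (φ₁ j)
  kl_zero_one_pos : 0 < InformationTheory.klDiv
    (densityMeasure (Measure.pi μ) (prodDensity φ₀)) (densityMeasure (Measure.pi μ) (prodDensity φ₁))
  kl_zero_one_lt_top : InformationTheory.klDiv
    (densityMeasure (Measure.pi μ) (prodDensity φ₀))
    (densityMeasure (Measure.pi μ) (prodDensity φ₁)) < (⊤ : ℝ≥0∞)
  kl_one_zero_pos : 0 < InformationTheory.klDiv
    (densityMeasure (Measure.pi μ) (prodDensity φ₁)) (densityMeasure (Measure.pi μ) (prodDensity φ₀))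
  kl_one_zero_lt_top : InformationTheory.klDiv
    (densityMeasure (Measure.pi μ) (prodDensity φ₁))
    (densityMeasure (Measure.pi μ) (prodDensity φ₀)) < (⊤ : ℝ≥0∞)

/-- The Chernoff `α`-divergence `-log ∫ f^(1-α) g^α dν`. -/
def chernoffDiv {X : Type u} [MeasurableSpace X] (ν : Measure X) (f g : X → ℝ) (α : ℝ) : ℝ :=
  -Real.log (∫ x, f x ^ (1 - α) * g x ^ α ∂ν)

/-- `α` maximizes the Chernoff `α`-divergence over the open interval `(0, 1)`. -/
def IsChernoffPoint {X : Type u} [MeasurableSpace X] (ν : Measure X) (f g : X → ℝ) (α : ℝ) : Prop :=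
  α ∈ Set.Ioo (0 : ℝ) 1 ∧ IsMaxOn (chernoffDiv ν f g) (Set.Ioo 0 1) α

/-- The law of a variable with the normalized density `f^(1-α) g^α exp(chernoffDiv)`. -/
def chernoffMeasure {X : Type u} [MeasurableSpace X] (ν : Measure X) (f g : X → ℝ) (α : ℝ) :
    Measure X :=
  densityMeasure ν fun x => f x ^ (1 - α) * g x ^ α * Real.exp (chernoffDiv ν f g α)

/-- The log-likelihood ratio `log (f / g)`. -/
def logRatio {X : Type u} (f g : X → ℝ) (x : X) : ℝ := Real.log (f x / g x)

/-- The centered log-likelihood ratio, as a function of `Y` with law `chernoffMeasure ν f g α`. -/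
def centeredLogRatio {X : Type u} [MeasurableSpace X] (ν : Measure X) (f g : X → ℝ) (α : ℝ)
    (y : X) : ℝ :=
  logRatio f g y - ∫ x, logRatio f g x ∂(chernoffMeasure ν f g α)

/-- The variance of the centered log-likelihood ratio under `chernoffMeasure ν f g α`. -/
def varZ {X : Type u} [MeasurableSpace X] (ν : Measure X) (f g : X → ℝ) (α : ℝ) : ℝ :=
  variance (centeredLogRatio ν f g α) (chernoffMeasure ν f g α)

/-- The third absolute moment of the centered log-likelihood ratio under
`chernoffMeasure ν f g α`. -/
def absThirdMomentZ {X : Type u} [MeasurableSpace X] (ν : Measure X) (f g : X → ℝ) (α : ℝ) : ℝ :=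
  ∫ y, |centeredLogRatio ν f g α y| ^ 3 ∂(chernoffMeasure ν f g α)

/-- The root of the average variance of the centered log-likelihood ratios of the coordinates. -/
def sigmaBar {n : ℕ} {Ω : Fin n → Type u} [∀ j, MeasurableSpace (Ω j)]
    (μ : ∀ j, Measure (Ω j)) (φ₀ φ₁ : ∀ j, Ω j → ℝ) (α : ℝ) : ℝ :=
  Real.sqrt ((1 / (n : ℝ)) * ∑ j, varZ (μ j) (φ₀ j) (φ₁ j) α)

/-- The function `x ↦ exp (min (α x) ((α - 1) x))`. -/
def gFun (α x : ℝ) : ℝ := Real.exp (min (α * x) ((α - 1) * x))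

/-- The expectation of `gFun α (log (f / g) (Y))` for `Y` with law `chernoffMeasure ν f g α`. -/
def expectG {X : Type u} [MeasurableSpace X] (ν : Measure X) (f g : X → ℝ) (α : ℝ) : ℝ :=
  ∫ y, gFun α (logRatio f g y) ∂(chernoffMeasure ν f g α)

/-- The total variation affinity `∫ min(f, g) dν`. -/
def affinity {X : Type u} [MeasurableSpace X] (ν : Measure X) (f g : X → ℝ) : ℝ :=
  ∫ x, min (f x) (g x) ∂ν

/-- An exponential family of densities `h(x) exp(θᵀ T(x) - A(θ))` with respect to `ν`, with
parameter `θ` in a convex set `Θ` of a Euclidean space. The function `A` is smooth on `Θ`; as usual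
for a set that need not be open, this means that it is (the restriction of) a function that is
smooth at every point of `Θ`. -/
structure ExponentialFamily {X : Type u} [MeasurableSpace X] (ν : Measure X) (d : ℕ) where
  /-- the base function -/
  h : X → ℝ
  /-- the sufficient statistic -/
  T : X → EuclideanSpace ℝ (Fin d)
  /-- the log-partition function -/
  A : EuclideanSpace ℝ (Fin d) → ℝ
  /-- the parameter space -/
  Θ : Set (EuclideanSpace ℝ (Fin d))
  measurable_h : Measurable h
  h_nonneg : ∀ x, 0 ≤ h x
  measurable_T : Measurable T
  convex_Θ : Convex ℝ Θ
  smooth_A : ∀ θ ∈ Θ, ContDiffAt ℝ ∞ A θ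
  integral_eq_one : ∀ θ ∈ Θ, ∫ x, h x * Real.exp (inner ℝ θ (T x) - A θ) ∂ν = 1

/-- The density of the exponential family at the parameter `θ`. -/
def ExponentialFamily.pdf {X : Type u} [MeasurableSpace X] {ν : Measure X} {d : ℕ}
    (E : ExponentialFamily ν d) (θ : EuclideanSpace ℝ (Fin d)) (x : X) : ℝ :=
  E.h x * Real.exp (inner ℝ θ (E.T x) - E.A θ)

/-- The Hessian matrix of second partial derivatives of `A` at `θ`. -/
def hessianMatrix {d : ℕ} (A : EuclideanSpace ℝ (Fin d) → ℝ) (θ : EuclideanSpace ℝ (Fin d)) :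
    Matrix (Fin d) (Fin d) ℝ :=
  Matrix.of fun i k =>
    iteratedFDeriv ℝ 2 A θ ![EuclideanSpace.single i 1, EuclideanSpace.single k 1]

/-- The quadratic form `vᵀ (Hess A(θ)) v`. -/
def hessianForm {d : ℕ} (A : EuclideanSpace ℝ (Fin d) → ℝ) (θ v : EuclideanSpace ℝ (Fin d)) : ℝ :=
  v.ofLp ⬝ᵥ (Matrix.mulVec (hessianMatrix A θ) v.ofLp)

end

/-! Write `L` for the log-likelihood ratio and `r` for `√n` times `sigmaBar`. Pointwise, `min(f, g)`
equals `f^(1-α) g^α` times `gFun α L`, so the affinity is exactly `expectG` times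
`exp(-chernoffDiv)` (`affinity_eq`). Everything reduces to showing that `expectG` is of order `1 /
(r (1-α) α)`.

The Chernoff law is an exponential tilt, so the derivative of `chernoffDiv` is the mean of `L` under
it. At the maximizer this mean vanishes, and `L` is almost surely a sum of independent centered
variables with total variance `r²` (`ae_logRatio_eq_sum`). The function `gFun α` peaks at 0 and has
integral `1/α + 1/(1-α) = 1/((1-α)α)`. It therefore suffices that, on scales above a constant, an
interval near 0 has probability comparable to its length divided by `r`.

Both halves of that comparison come from Stein's exchange formula with a truncated linear test
function. The upper half is the Chen–Shao inequality `measureReal_sum_mem_Icc_le`, integrated over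
the level sets of `gFun` in `integral_gFun_le`. The lower half is `le_measureReal_abs_sum_sub_le`,
applied in `exists_bounds_integral_gFun` to one window of length of order `1/((1-α)α)` on which
`gFun` is bounded below.

The maximizer exists and is unique because `∫ f^(1-α) g^α` is continuous and strictly convex on `[0,
1]` with value 1 at both ends. For exponential families the geometric mean of two members is, up to
a constant factor, the member at the interpolated parameter. Hence the divergence is a Jensen gap of
`A`, and the variance is a second derivative of `A` along a segment. -/

set_option linter.unusedSectionVars false

/-! ### Sums of independent centered variables and the exchange formula. -/

/-- A family of independent centered random variables with finite third moments. -/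
structure IsCenteredFamily {ι Ω : Type*} [MeasurableSpace Ω] (X : ι → Ω → ℝ) (P : Measure Ω) :
    Prop where
  measurable : ∀ i, Measurable (X i)
  indep : iIndepFun X P
  memLp : ∀ i, MemLp (X i) 3 P
  mean : ∀ i, ∫ w, X i w ∂P = 0

namespace IsCenteredFamily

variable {ι Ω : Type*} [MeasurableSpace Ω] {P : Measure Ω} [IsProbabilityMeasure P]
  {X : ι → Ω → ℝ}

theorem memLp_two (h : IsCenteredFamily X P) (i : ι) : MemLp (X i) 2 P :=
  (h.memLp i).mono_exponent (by norm_num)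

theorem integrable (h : IsCenteredFamily X P) (i : ι) : Integrable (X i) P :=
  (h.memLp i).integrable (by norm_num)

theorem integrable_sq (h : IsCenteredFamily X P) (i : ι) : Integrable (fun w => X i w ^ 2) P :=
  (h.memLp_two i).integrable_sq

theorem integrable_abs_cube (h : IsCenteredFamily X P) (i : ι) :
    Integrable (fun w => |X i w| ^ 3) P := by
  have := (h.memLp i).integrable_norm_pow (by norm_num)
  simpa using this

theorem measurable_sum (h : IsCenteredFamily X P) (s : Finset ι) :
    Measurable fun w => ∑ i ∈ s, X i w :=
  Finset.measurable_sum _ fun i _ => h.measurable i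

theorem memLp_two_sum (h : IsCenteredFamily X P) (s : Finset ι) :
    MemLp (fun w => ∑ i ∈ s, X i w) 2 P :=
  memLp_finsetSum _ fun i _ => h.memLp_two i

theorem integrable_sum (h : IsCenteredFamily X P) (s : Finset ι) :
    Integrable (fun w => ∑ i ∈ s, X i w) P :=
  integrable_finsetSum _ fun i _ => h.integrable i

theorem integral_sum_sq (h : IsCenteredFamily X P) (s : Finset ι) :
    ∫ w, (∑ i ∈ s, X i w) ^ 2 ∂P = ∑ i ∈ s, ∫ w, X i w ^ 2 ∂P := by
  have h1 := IndepFun.variance_sum (μ := P) (X := X) (s := s) (fun i _ => h.memLp_two i)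
    (fun i _ j _ hij => h.indep.indepFun hij)
  have h2 : (∑ i ∈ s, X i) = fun w => ∑ i ∈ s, X i w := by ext; simp
  rw [h2, variance_of_integral_eq_zero (h.measurable_sum s).aemeasurable] at h1
  · rw [h1]
    refine Finset.sum_congr rfl fun i _ => ?_
    rw [variance_of_integral_eq_zero (h.measurable i).aemeasurable (h.mean i)]
  · rw [integral_finsetSum _ fun i _ => h.integrable i]
    simp [h.mean]

theorem integral_abs_sum_le (h : IsCenteredFamily X P) (s : Finset ι)
    (hV : 0 < ∑ i ∈ s, ∫ w, X i w ^ 2 ∂P) :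
    ∫ w, |∑ i ∈ s, X i w| ∂P ≤ √(∑ i ∈ s, ∫ w, X i w ^ 2 ∂P) := by
  set V := ∑ i ∈ s, ∫ w, X i w ^ 2 ∂P
  have ht : 0 < √V := Real.sqrt_pos.2 hV
  have hV' : √V ^ 2 = V := Real.sq_sqrt hV.le
  calc ∫ w, |∑ i ∈ s, X i w| ∂P
      ≤ ∫ w, ((∑ i ∈ s, X i w) ^ 2 / (2 * √V) + √V / 2) ∂P := by
        refine integral_mono (h.integrable_sum s).abs
          (((h.memLp_two_sum s).integrable_sq.div_const _).add (integrable_const _)) fun w => ?_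
        have : 0 ≤ (|∑ i ∈ s, X i w| - √V) ^ 2 := sq_nonneg _
        have h3 := sq_abs (∑ i ∈ s, X i w)
        dsimp only
        rw [← h3]
        rw [← sub_nonneg]
        have : |∑ i ∈ s, X i w| ^ 2 / (2 * √V) + √V / 2 - |∑ i ∈ s, X i w|
          = (|∑ i ∈ s, X i w| - √V) ^ 2 / (2 * √V) := by field_simp; ring
        rw [this]; positivity
    _ = √V := by
        rw [integral_add ((h.memLp_two_sum s).integrable_sq.div_const _) (integrable_const _),
          integral_div, h.integral_sum_sq s]
        change V / (2 * √V) + _ = _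
        nth_rewrite 1 [← hV']
        simp; field_simp; ring

theorem indepFun_sum_erase [DecidableEq ι] (h : IsCenteredFamily X P) (s : Finset ι) (i : ι) :
    IndepFun (X i) (fun w => ∑ j ∈ s.erase i, X j w) P := by
  have := (h.indep.indepFun_finsetSum_of_notMem h.measurable (Finset.notMem_erase i s)).symm
  convert this using 1
  ext; simp

theorem sum_erase_eq [DecidableEq ι] {s : Finset ι} {i : ι} (hi : i ∈ s) (w : Ω) :
    ∑ j ∈ s.erase i, X j w = ∑ j ∈ s, X j w - X i w := by
  rw [← Finset.add_sum_erase s (fun j => X j w) hi]; ring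

theorem integrable_mul_bdd (h : IsCenteredFamily X P) (i : ι) {g : Ω → ℝ} (hg : Measurable g)
    {B : ℝ} (hB : ∀ w, |g w| ≤ B) : Integrable (fun w => X i w * g w) P :=
  (h.integrable i).mul_bdd hg.aestronglyMeasurable (.of_forall hB)

/-- The exchange formula of Stein's method. -/
theorem integral_sum_mul [DecidableEq ι] (h : IsCenteredFamily X P) (s : Finset ι) {f : ℝ → ℝ}
    (hf : Measurable f) {B : ℝ} (hB : ∀ x, |f x| ≤ B) :
    ∫ w, (∑ i ∈ s, X i w) * f (∑ i ∈ s, X i w) ∂P =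
      ∑ i ∈ s, ∫ w, X i w * (f (∑ j ∈ s.erase i, X j w + X i w)
        - f (∑ j ∈ s.erase i, X j w)) ∂P := by
  have hm : ∀ t : Finset ι, Measurable fun w => f (∑ j ∈ t, X j w) :=
    fun t => hf.comp (h.measurable_sum t)
  simp_rw [Finset.sum_mul]
  rw [integral_finsetSum s fun i _ => h.integrable_mul_bdd i (hm s) fun w => hB _]
  refine Finset.sum_congr rfl fun i hi => ?_
  -- The sum without `X i` is independent of `X i`, which has mean zero, so this term can be
  -- subtracted for free.
  have h0 : ∫ w, X i w * f (∑ j ∈ s.erase i, X j w) ∂P = 0 := by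
    have h1 : IndepFun (X i) (fun w => f (∑ j ∈ s.erase i, X j w)) P :=
      (h.indepFun_sum_erase s i).comp measurable_id hf
    rw [h1.integral_fun_mul_eq_mul_integral (h.measurable i).aestronglyMeasurable
      (hm _).aestronglyMeasurable, h.mean i, zero_mul]
  have h2 : ∀ w, X i w * (f (∑ j ∈ s.erase i, X j w + X i w) - f (∑ j ∈ s.erase i, X j w))
      = X i w * f (∑ j ∈ s, X j w) - X i w * f (∑ j ∈ s.erase i, X j w) := fun w => by
    rw [sum_erase_eq hi]; ring_nf
  simp_rw [h2]
  rw [integral_sub (h.integrable_mul_bdd i (hm s) fun w => hB _)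
    (h.integrable_mul_bdd i (hm _) fun w => hB _), h0, sub_zero]

end IsCenteredFamily

/-! ### Truncated linear test functions and the concentration inequality. -/

/-- The truncation of `x` to the interval `[-L, L]`. -/
def clip (L x : ℝ) : ℝ := max (-L) (min L x)

theorem measurable_clip_sub (L c : ℝ) : Measurable fun x => clip L (x - c) :=
  (continuous_const.max (continuous_const.min (continuous_id.sub continuous_const))).measurable

theorem abs_clip_le {L : ℝ} (hL : 0 ≤ L) (x : ℝ) : |clip L x| ≤ L :=
  abs_le.2 ⟨le_max_left _ _, max_le (by linarith) (min_le_left _ _)⟩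

theorem clip_mono (L : ℝ) : Monotone (clip L) := fun _ _ hxy =>
  max_le_max le_rfl (min_le_min le_rfl hxy)

theorem clip_of_abs_le {L x : ℝ} (h : |x| ≤ L) : clip L x = x := by
  obtain ⟨h1, h2⟩ := abs_le.1 h
  rw [clip, min_eq_right h2, max_eq_right h1]

theorem clip_of_le {L x : ℝ} (hL : 0 ≤ L) (h : L ≤ x) : clip L x = L := by
  rw [clip, min_eq_left h, max_eq_right (by linarith)]

theorem clip_of_le_neg {L x : ℝ} (hL : 0 ≤ L) (h : x ≤ -L) : clip L x = -L := by
  rw [clip, min_eq_right (by linarith), max_eq_left h]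

theorem mul_clip_sub_clip_nonneg (L x z : ℝ) : 0 ≤ z * (clip L (x + z) - clip L x) := by
  rcases le_total 0 z with hz | hz
  · exact mul_nonneg hz (sub_nonneg.2 (clip_mono L (by linarith)))
  · exact mul_nonneg_of_nonpos_of_nonpos hz (sub_nonpos.2 (clip_mono L (by linarith)))

/-- The point `x + z` keeps distance `δ` from both ends of the stretch of slope one, so moving back
by `z` changes `clip` by at least `min δ |z|`, in the direction of `z`. -/
theorem abs_mul_min_le_mul_clip_sub_clip {L δ x z : ℝ} (hδ : 0 ≤ δ) (hx : |x + z| ≤ L - δ) :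
    |z| * min δ |z| ≤ z * (clip L (x + z) - clip L x) := by
  rw [clip_of_abs_le (x := x + z) (by linarith)]
  obtain ⟨h1, h2⟩ := abs_le.1 hx
  rcases le_total 0 z with hz | hz
  · rw [abs_of_nonneg hz]
    refine mul_le_mul_of_nonneg_left ?_ hz
    rcases le_total (-L) x with h | h
    · rw [clip_of_abs_le (abs_le.2 ⟨h, by linarith⟩)]
      exact (min_le_right _ _).trans (by linarith)
    · rw [clip_of_le_neg (by linarith) h]
      exact (min_le_left _ _).trans (by linarith)
  · rw [abs_of_nonpos hz, neg_mul, ← mul_neg]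
    refine mul_le_mul_of_nonpos_left ?_ hz
    rcases le_total x L with h | h
    · rw [clip_of_abs_le (abs_le.2 ⟨by linarith, h⟩)]
      have := min_le_right δ (-z)
      linarith
    · rw [clip_of_le (by linarith) h]
      have := min_le_left δ (-z)
      linarith

/-- `clip` is 1-Lipschitz, and it takes equal values at `x` and `x + z` when `x` is farther than
`|z|` outside `[-L, L]`. -/
theorem mul_clip_sub_clip_le {L x z : ℝ} (hL : 0 ≤ L) :
    z * (clip L (x + z) - clip L x) ≤ if |x| ≤ L + |z| then z ^ 2 else 0 := by
  split_ifs with h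
  · have h1 : |clip L (x + z) - clip L x| ≤ |z| := by
      have := (abs_max_sub_max_le_abs (min L (x + z)) (min L x) (-L))
      have h2 := abs_min_sub_min_le_max L (x + z) L x
      simp only [clip, max_comm (-L)]
      refine this.trans (h2.trans ?_)
      simp
    calc _ ≤ |z * (clip L (x + z) - clip L x)| := le_abs_self _
      _ ≤ |z| * |z| := by rw [abs_mul]; gcongr
      _ = z ^ 2 := by rw [← sq, sq_abs]
  · push Not at h
    rcases lt_abs.1 h with h | h
    · have := neg_abs_le z
      have := abs_nonneg z
      rw [clip_of_le hL (by linarith), clip_of_le hL (by linarith)]; simp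
    · have := le_abs_self z
      have := abs_nonneg z
      rw [clip_of_le_neg hL (by linarith), clip_of_le_neg hL (by linarith)]; simp

namespace IsCenteredFamily

variable {ι Ω : Type*} [MeasurableSpace Ω] {P : Measure Ω} [IsProbabilityMeasure P]
  {X : ι → Ω → ℝ}

/-- The Chen-Shao concentration inequality. -/
theorem measureReal_sum_mem_Icc_le [DecidableEq ι] (h : IsCenteredFamily X P) (s : Finset ι)
    {δ : ℝ} (hδ : 0 < δ) (hV : 0 < ∑ i ∈ s, ∫ w, X i w ^ 2 ∂P)
    (h3 : ∑ i ∈ s, ∫ w, |X i w| ^ 3 ∂P ≤ 2 * δ * ∑ i ∈ s, ∫ w, X i w ^ 2 ∂P)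
    {a b : ℝ} (hab : a ≤ b) :
    P.real {w | ∑ i ∈ s, X i w ∈ Set.Icc a b} ≤
      (2 * (b - a) + 4 * δ) / √(∑ i ∈ s, ∫ w, X i w ^ 2 ∂P)
        + 4 * δ ^ 2 / ∑ i ∈ s, ∫ w, X i w ^ 2 ∂P := by
  have hle := h.integral_abs_sum_le s hV
  set V := ∑ i ∈ s, ∫ w, X i w ^ 2 ∂P with hVdef
  set I : Set Ω := {w | ∑ i ∈ s, X i w ∈ Set.Icc a b} with hI
  have hIm : MeasurableSet I := h.measurable_sum s measurableSet_Icc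
  -- With `c` the midpoint of `[a, b]`, the test function `clip L (x - c)` has slope one on `[a - δ,
  -- b + δ]`. Its size `L` bounds one side of the exchange formula, its slope bounds the other side
  -- from below on the event `I`.
  set L := (b - a) / 2 + δ with hLdef
  have hL : 0 ≤ L := by linarith
  set c := (a + b) / 2 with hc
  set ψ : ℝ → ℝ := fun z => |z| * min δ |z| with hψ
  have hψm : Measurable ψ := (continuous_abs.mul (continuous_const.min continuous_abs)).measurable
  have hψ0 : ∀ z, 0 ≤ ψ z := fun z => mul_nonneg (abs_nonneg _) (le_min hδ.le (abs_nonneg _))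
  have hψ1 : ∀ z, ψ z ≤ δ * |z| := fun z => by
    rw [mul_comm δ]; exact mul_le_mul_of_nonneg_left (min_le_left _ _) (abs_nonneg _)
  -- The factor `4 * δ` is what `(|z| - 2δ)² ≥ 0` allows; with the third-moment hypothesis it leaves
  -- at least half of the variance in `m`.
  have hψ2 : ∀ z, z ^ 2 - |z| ^ 3 / (4 * δ) ≤ ψ z := fun z => by
    have : z ^ 2 - |z| ^ 3 / (4 * δ) = |z| * (|z| - |z| ^ 2 / (4 * δ)) := by
      rw [← sq_abs]; field_simp
    rw [this]
    refine mul_le_mul_of_nonneg_left (le_min ?_ ?_) (abs_nonneg _)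
    · rw [sub_le_iff_le_add, ← sub_le_iff_le_add', le_div_iff₀ (by positivity)]
      nlinarith [sq_nonneg (|z| - 2 * δ)]
    · have : 0 ≤ |z| ^ 2 / (4 * δ) := by positivity
      linarith
  have hψL : ∀ i, MemLp (fun w => ψ (X i w)) 2 P := fun i => by
    refine ((h.memLp_two i).const_mul δ).mono (hψm.comp (h.measurable i)).aestronglyMeasurable
      (.of_forall fun w => ?_)
    rw [Real.norm_eq_abs, abs_of_nonneg (hψ0 _), norm_mul, Real.norm_eq_abs, Real.norm_eq_abs,
      abs_of_pos hδ]
    exact hψ1 _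
  set η : Ω → ℝ := fun w => ∑ i ∈ s, ψ (X i w) with hη
  have hηL : MemLp η 2 P := memLp_finsetSum _ fun i _ => hψL i
  set m := ∫ w, η w ∂P with hm
  have hmV : V / 2 ≤ m := by
    have h1 : ∀ i, ∫ w, X i w ^ 2 ∂P - (∫ w, |X i w| ^ 3 ∂P) / (4 * δ) ≤ ∫ w, ψ (X i w) ∂P := by
      intro i
      rw [← integral_div, ← integral_sub (h.integrable_sq i) ((h.integrable_abs_cube i).div_const _)]
      exact integral_mono ((h.integrable_sq i).sub ((h.integrable_abs_cube i).div_const _))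
        ((hψL i).integrable (by norm_num)) fun w => hψ2 _
    have h2 := Finset.sum_le_sum fun i (_ : i ∈ s) => h1 i
    rw [Finset.sum_sub_distrib, ← Finset.sum_div,
      ← integral_finsetSum _ fun i _ => (hψL i).integrable (by norm_num)] at h2
    have h4 : (∑ i ∈ s, ∫ w, |X i w| ^ 3 ∂P) / (4 * δ) ≤ V / 2 := by
      rw [div_le_iff₀ (by positivity)]
      linarith
    change V - _ ≤ m at h2
    linarith
  have hm0 : 0 < m := by linarith
  have hvar : ∫ w, (η w - m) ^ 2 ∂P ≤ δ ^ 2 * V := by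
    have h1 := IndepFun.variance_sum (μ := P) (X := fun i w => ψ (X i w)) (s := s)
      (fun i _ => hψL i) (fun i _ j _ hij => (h.indep.indepFun hij).comp hψm hψm)
    have h2 : (∑ i ∈ s, fun w => ψ (X i w)) = η := by ext; simp [hη]
    rw [h2, variance_eq_integral hηL.aemeasurable] at h1
    rw [h1, hVdef, Finset.mul_sum]
    refine Finset.sum_le_sum fun i _ => ?_
    refine (variance_le_expectation_sq (hψL i).aestronglyMeasurable).trans ?_
    rw [← integral_const_mul]
    refine integral_mono (hψL i).integrable_sq ((h.integrable_sq i).const_mul _) fun w => ?_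
    simp only [Pi.pow_apply]
    calc ψ (X i w) ^ 2 ≤ (δ * |X i w|) ^ 2 := by
          exact pow_le_pow_left₀ (hψ0 _) (hψ1 _) 2
      _ = _ := by rw [mul_pow, sq_abs]
  have hvarint : Integrable (fun w => (η w - m) ^ 2) P :=
    (hηL.sub (memLp_const m)).integrable_sq
  have hstein := h.integral_sum_mul s (measurable_clip_sub L c) fun x => abs_clip_le hL (x - c)
  have hup : ∫ w, (∑ i ∈ s, X i w) * clip L (∑ i ∈ s, X i w - c) ∂P ≤ L * √V := by
    refine le_trans ?_ (mul_le_mul_of_nonneg_left hle hL)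
    rw [← integral_const_mul]
    refine integral_mono
      ((h.integrable_sum s).mul_bdd
        ((measurable_clip_sub L c).comp (h.measurable_sum s)).aestronglyMeasurable
        (.of_forall fun w => abs_clip_le hL _))
      ((h.integrable_sum s).abs.const_mul L) fun w => ?_
    dsimp only
    refine (le_abs_self _).trans ?_
    rw [abs_mul, mul_comm]
    exact mul_le_mul_of_nonneg_right (abs_clip_le hL _) (abs_nonneg _)
  rw [hstein, ← integral_finsetSum] at hup
  swap
  · intro i _
    refine h.integrable_mul_bdd i (B := L + L) ?_ fun w => ?_
    · exact ((measurable_clip_sub L c).comp ((h.measurable_sum _).add (h.measurable i))).sub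
        ((measurable_clip_sub L c).comp (h.measurable_sum _))
    · exact (abs_sub _ _).trans (add_le_add (abs_clip_le hL _) (abs_clip_le hL _))
  have hlow : ∫ w, (I.indicator (fun _ => m / 2) w - (η w - m) ^ 2 / (2 * m)) ∂P ≤
      ∫ w, ∑ i ∈ s, X i w * (clip L (∑ j ∈ s.erase i, X j w + X i w - c)
        - clip L (∑ j ∈ s.erase i, X j w - c)) ∂P := by
    refine integral_mono (((integrable_const _).indicator hIm).sub (hvarint.div_const _)) ?_
      fun w => ?_
    · refine integrable_finsetSum _ fun i _ => h.integrable_mul_bdd i (B := L + L) ?_ fun w => ?_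
      · exact ((measurable_clip_sub L c).comp ((h.measurable_sum _).add (h.measurable i))).sub
          ((measurable_clip_sub L c).comp (h.measurable_sum _))
      · exact (abs_sub _ _).trans (add_le_add (abs_clip_le hL _) (abs_clip_le hL _))
    · dsimp only
      have hsq : 0 ≤ (η w - m) ^ 2 / (2 * m) := by positivity
      have hre : ∀ i, ∑ j ∈ s.erase i, X j w + X i w - c = (∑ j ∈ s.erase i, X j w - c) + X i w :=
        fun i => by ring
      simp_rw [hre]
      by_cases hw : w ∈ I
      · rw [Set.indicator_of_mem hw]
        -- This decouples `η` from the event `I`: on `I`, `η` may be replaced by `m / 2` at the cost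
        -- of a term whose mean is controlled by the variance of `η`.
        have h5 : m / 2 - (η w - m) ^ 2 / (2 * m) ≤ η w := by
          have : η w - (m / 2 - (η w - m) ^ 2 / (2 * m)) = η w ^ 2 / (2 * m) := by
            field_simp; ring
          have h6 : 0 ≤ η w ^ 2 / (2 * m) := by positivity
          linarith
        refine h5.trans (Finset.sum_le_sum fun i hi => ?_)
        refine abs_mul_min_le_mul_clip_sub_clip hδ.le ?_
        rw [sum_erase_eq hi]
        obtain ⟨h6, h7⟩ : a ≤ ∑ i ∈ s, X i w ∧ ∑ i ∈ s, X i w ≤ b := hw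
        rw [abs_le]; constructor <;> linarith
      · rw [Set.indicator_of_notMem hw]
        have : 0 ≤ ∑ i ∈ s, X i w * (clip L ((∑ j ∈ s.erase i, X j w - c) + X i w)
          - clip L (∑ j ∈ s.erase i, X j w - c)) :=
          Finset.sum_nonneg fun i _ => mul_clip_sub_clip_nonneg _ _ _
        linarith
  have hfin := hlow.trans hup
  rw [integral_sub ((integrable_const _).indicator hIm) (hvarint.div_const _),
    integral_indicator_const _ hIm, integral_div, smul_eq_mul] at hfin
  have hs : 0 < √V := Real.sqrt_pos.2 hV
  have h8 : (∫ w, (η w - m) ^ 2 ∂P) / (2 * m) ≤ δ ^ 2 := by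
    rw [div_le_iff₀ (by positivity)]
    nlinarith [sq_nonneg δ]
  have h9 : P.real I * (V / 4) ≤ L * √V + δ ^ 2 := by
    have : P.real I * (V / 4) ≤ P.real I * (m / 2) :=
      mul_le_mul_of_nonneg_left (by linarith) measureReal_nonneg
    linarith
  have h10 : (2 * (b - a) + 4 * δ) / √V + 4 * δ ^ 2 / V = (L * √V + δ ^ 2) / (V / 4) := by
    have : V = √V * √V := (Real.mul_self_sqrt hV.le).symm
    rw [hLdef]
    generalize √V = r at *
    rw [this]
    field_simp
    ring
  rw [h10, le_div_iff₀ (by positivity)]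
  exact h9

end IsCenteredFamily

/-! ### Concentration after removal of a summand, and lower bounds for the probability of a window.
-/

theorem integral_mul_indicator_le_of_indepFun {Ω : Type*} [MeasurableSpace Ω] {P : Measure Ω}
    [IsProbabilityMeasure P] {X Y : Ω → ℝ} (hX : Measurable X) (hY : Measurable Y)
    (hXY : IndepFun X Y P) {φ κ : ℝ → ℝ} (hφ : Measurable φ) (hφ0 : ∀ z, 0 ≤ φ z)
    (hκ : Measurable κ) {A : Set (ℝ × ℝ)} (hA : MeasurableSet A)
    (hAκ : ∀ z, P.real {w | (z, Y w) ∈ A} ≤ κ z)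
    (hφX : Integrable (fun w => φ (X w)) P) (hφκ : Integrable (fun w => φ (X w) * κ (X w)) P) :
    ∫ w, φ (X w) * A.indicator 1 (X w, Y w) ∂P ≤ ∫ w, φ (X w) * κ (X w) ∂P := by
  have hmap := (indepFun_iff_map_prod_eq_prod_map_map hX.aemeasurable hY.aemeasurable).1 hXY
  have hpX := Measure.isProbabilityMeasure_map (μ := P) hX.aemeasurable
  have hpY := Measure.isProbabilityMeasure_map (μ := P) hY.aemeasurable
  have hind : Measurable (A.indicator (1 : ℝ × ℝ → ℝ)) := measurable_one.indicator hA
  have hgm : Measurable fun q : ℝ × ℝ => φ q.1 * A.indicator 1 q := (hφ.comp measurable_fst).mul hind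
  have hint : Integrable (fun q : ℝ × ℝ => φ q.1 * A.indicator 1 q) (P.map fun w => (X w, Y w)) := by
    rw [integrable_map_measure hgm.aestronglyMeasurable (hX.prodMk hY).aemeasurable]
    refine Integrable.mono hφX (hgm.comp (hX.prodMk hY)).aestronglyMeasurable
      (.of_forall fun w => ?_)
    simp only [Function.comp, norm_mul, Real.norm_eq_abs]
    refine mul_le_of_le_one_right (abs_nonneg _) ?_
    by_cases h : (X w, Y w) ∈ A <;> simp [h]
  have h1 : ∫ w, φ (X w) * A.indicator 1 (X w, Y w) ∂P
      = ∫ q, φ q.1 * A.indicator 1 q ∂(P.map fun w => (X w, Y w)) :=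
    (integral_map (hX.prodMk hY).aemeasurable hgm.aestronglyMeasurable).symm
  have h2 : ∫ w, φ (X w) * κ (X w) ∂P = ∫ z, φ z * κ z ∂(P.map X) :=
    (integral_map hX.aemeasurable (hφ.mul hκ).aestronglyMeasurable).symm
  -- By independence the joint law is a product, so the inner integral freezes `X = z` and sees only
  -- a slice of `A`. This lets concentration of `Y` be used on sets whose width depends on `X`.
  rw [h1, h2, hmap]
  rw [hmap] at hint
  rw [integral_prod _ hint]
  refine integral_mono hint.integral_prod_left ?_ fun z => ?_
  · exact (integrable_map_measure (hφ.mul hκ).aestronglyMeasurable hX.aemeasurable).2 hφκ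
  · dsimp only
    rw [integral_const_mul]
    refine mul_le_mul_of_nonneg_left ?_ (hφ0 z)
    have hAz : MeasurableSet {y | (z, y) ∈ A} := measurable_prodMk_left hA
    have h3 : ∀ y, A.indicator (1 : ℝ × ℝ → ℝ) (z, y) = {y | (z, y) ∈ A}.indicator 1 y :=
      fun y => by by_cases h : (z, y) ∈ A <;> simp [h]
    simp_rw [h3]
    rw [integral_indicator_one hAz, map_measureReal_apply hY hAz]
    exact hAκ z

namespace IsCenteredFamily

variable {ι Ω : Type*} [MeasurableSpace Ω] {P : Measure Ω} [IsProbabilityMeasure P]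
  {X : ι → Ω → ℝ} [DecidableEq ι]

theorem measureReal_sum_mem_Icc_le_of_one_le (h : IsCenteredFamily X P) (s : Finset ι)
    {K : ℝ} (hK : 1 ≤ K) (hV : 0 < ∑ i ∈ s, ∫ w, X i w ^ 2 ∂P)
    (h3 : ∑ i ∈ s, ∫ w, |X i w| ^ 3 ∂P ≤ 2 * K * ∑ i ∈ s, ∫ w, X i w ^ 2 ∂P)
    {a b : ℝ} (hab : a ≤ b) :
    P.real {w | ∑ i ∈ s, X i w ∈ Set.Icc a b} ≤
      8 * K ^ 2 * (b - a + 1) / √(∑ i ∈ s, ∫ w, X i w ^ 2 ∂P) := by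
  have h0 := h.measureReal_sum_mem_Icc_le s (by linarith : 0 < K) hV h3 hab
  set V := ∑ i ∈ s, ∫ w, X i w ^ 2 ∂P
  have hr : 0 < √V := Real.sqrt_pos.2 hV
  have hr2 : √V ^ 2 = V := Real.sq_sqrt hV.le
  have hKK : 1 ≤ K ^ 2 := one_le_pow₀ hK
  -- For `√V ≥ 1` the term in `1 / V` is absorbed into `1 / √V`; for `√V ≤ 1` the claimed bound
  -- exceeds 1.
  rcases le_total 1 (√V) with h1 | h1
  · refine h0.trans ?_
    have h2 : 4 * K ^ 2 / V ≤ 4 * K ^ 2 / √V := by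
      gcongr
      nlinarith
    refine (add_le_add_right h2 _).trans ?_
    rw [← add_div]
    gcongr
    nlinarith [mul_nonneg (sub_nonneg.2 hab) (sub_nonneg.2 hKK)]
  · refine measureReal_le_one.trans ?_
    rw [le_div_iff₀ hr]
    nlinarith [mul_nonneg (sub_nonneg.2 hab) (sub_nonneg.2 hKK)]

theorem measureReal_sum_mem_Icc_le_of_le (h : IsCenteredFamily X P) (s : Finset ι)
    {K : ℝ} (hK : 1 ≤ K) (hV : 0 < ∑ i ∈ s, ∫ w, X i w ^ 2 ∂P)
    (h3 : ∑ i ∈ s, ∫ w, |X i w| ^ 3 ∂P ≤ K * ∑ i ∈ s, ∫ w, X i w ^ 2 ∂P)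
    {a b : ℝ} (hab : a ≤ b) :
    P.real {w | ∑ i ∈ s, X i w ∈ Set.Icc a b} ≤
      16 * K ^ 2 * (b - a + 1) / √(∑ i ∈ s, ∫ w, X i w ^ 2 ∂P) := by
  have h4 : 0 ≤ K * ∑ i ∈ s, ∫ w, X i w ^ 2 ∂P := by positivity
  refine (h.measureReal_sum_mem_Icc_le_of_one_le s hK hV (by linarith) hab).trans ?_
  have : 0 ≤ b - a := sub_nonneg.2 hab
  gcongr
  norm_num

/-- No single summand dominates: its variance is at most `16K²` plus its third moment over `4K`,
hence at most half of the total. The remaining sum has variance at least `V / 2` and third-moment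
ratio at most `2K`, so concentration survives with twice the constant. -/
theorem measureReal_sum_erase_mem_Icc_le (h : IsCenteredFamily X P) {s : Finset ι}
    {K : ℝ} (hK : 1 ≤ K) (hV : 64 * K ^ 2 ≤ ∑ i ∈ s, ∫ w, X i w ^ 2 ∂P)
    (h3 : ∑ i ∈ s, ∫ w, |X i w| ^ 3 ∂P ≤ K * ∑ i ∈ s, ∫ w, X i w ^ 2 ∂P)
    {i : ι} (hi : i ∈ s) {a b : ℝ} (hab : a ≤ b) :
    P.real {w | ∑ j ∈ s.erase i, X j w ∈ Set.Icc a b} ≤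
      16 * K ^ 2 * (b - a + 1) / √(∑ i ∈ s, ∫ w, X i w ^ 2 ∂P) := by
  have hρ0 : ∀ j, 0 ≤ ∫ w, |X j w| ^ 3 ∂P := fun j => integral_nonneg fun w => by positivity
  have h4 : ∫ w, X i w ^ 2 ∂P ≤ 16 * K ^ 2 + (∫ w, |X i w| ^ 3 ∂P) / (4 * K) := by
    have h5 : ∫ w, (16 * K ^ 2 + |X i w| ^ 3 / (4 * K)) ∂P
        = 16 * K ^ 2 + (∫ w, |X i w| ^ 3 ∂P) / (4 * K) := by
      rw [integral_add (integrable_const _) ((h.integrable_abs_cube i).div_const _), integral_div]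
      simp
    rw [← h5]
    refine integral_mono (h.integrable_sq i)
      ((integrable_const _).add ((h.integrable_abs_cube i).div_const _)) fun w => ?_
    dsimp only
    rw [← sq_abs (X i w)]
    have := abs_nonneg (X i w)
    rcases le_total |X i w| (4 * K) with h6 | h6
    · have : 0 ≤ |X i w| ^ 3 / (4 * K) := by positivity
      nlinarith
    · have : |X i w| ^ 2 ≤ |X i w| ^ 3 / (4 * K) := by
        rw [le_div_iff₀ (by positivity), pow_succ |X i w| 2]
        gcongr
      nlinarith [sq_nonneg K]
  have h5 : (∫ w, |X i w| ^ 3 ∂P) / (4 * K) ≤ (∑ i ∈ s, ∫ w, X i w ^ 2 ∂P) / 4 := by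
    rw [div_le_div_iff₀ (by positivity) (by norm_num)]
    have := (Finset.single_le_sum (fun j _ => hρ0 j) hi).trans h3
    linarith
  have hVe := Finset.add_sum_erase s (fun j => ∫ w, X j w ^ 2 ∂P) hi
  have h3e := Finset.add_sum_erase s (fun j => ∫ w, |X j w| ^ 3 ∂P) hi
  have hhalf : (∑ i ∈ s, ∫ w, X i w ^ 2 ∂P) / 2 ≤ ∑ j ∈ s.erase i, ∫ w, X j w ^ 2 ∂P := by
    linarith
  have hV0 : 0 < ∑ i ∈ s, ∫ w, X i w ^ 2 ∂P := by nlinarith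
  refine (h.measureReal_sum_mem_Icc_le_of_one_le (s.erase i) hK (by linarith) ?_ hab).trans ?_
  · have := hρ0 i
    nlinarith
  · have hr : √(∑ i ∈ s, ∫ w, X i w ^ 2 ∂P) / 2 ≤ √(∑ j ∈ s.erase i, ∫ w, X j w ^ 2 ∂P) := by
      refine Real.le_sqrt_of_sq_le ?_
      rw [div_pow, Real.sq_sqrt hV0.le]
      linarith
    have hr0 : 0 < √(∑ i ∈ s, ∫ w, X i w ^ 2 ∂P) := Real.sqrt_pos.2 hV0
    have hba : 0 ≤ b - a := sub_nonneg.2 hab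
    calc _ ≤ 8 * K ^ 2 * (b - a + 1) / (√(∑ i ∈ s, ∫ w, X i w ^ 2 ∂P) / 2) := by gcongr
      _ = _ := by field_simp; norm_num

/-- By concentration, `|S| > t` with probability at least 1/2 for `t = r / (8D)`, so the mean of
`|S|` is at least `t / 2`. -/
theorem le_integral_abs_sum (h : IsCenteredFamily X P) (s : Finset ι) {D r : ℝ} (hD : 0 < D)
    (hr : 4 * D ≤ r) (hc : ∀ a b : ℝ, a ≤ b →
      P.real {w | ∑ i ∈ s, X i w ∈ Set.Icc a b} ≤ D * (b - a + 1) / r) :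
    r / (16 * D) ≤ ∫ w, |∑ i ∈ s, X i w| ∂P := by
  have hr0 : 0 < r := by linarith
  set t := r / (8 * D) with ht
  have ht0 : 0 < t := by positivity
  have hm : MeasurableSet {w | ∑ i ∈ s, X i w ∈ Set.Icc (-t) t} :=
    h.measurable_sum s measurableSet_Icc
  have h1 : P.real {w | ∑ i ∈ s, X i w ∈ Set.Icc (-t) t} ≤ 1 / 2 := by
    refine (hc (-t) t (by linarith)).trans ?_
    rw [div_le_iff₀ hr0]
    have : D * (t - -t + 1) = r / 4 + D := by rw [ht]; field_simp; ring
    rw [this]; linarith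
  have h2 : ∫ w, (t - {w | ∑ i ∈ s, X i w ∈ Set.Icc (-t) t}.indicator (fun _ => t) w) ∂P
      ≤ ∫ w, |∑ i ∈ s, X i w| ∂P := by
    refine integral_mono ((integrable_const _).sub ((integrable_const _).indicator hm))
      (h.integrable_sum s).abs fun w => ?_
    dsimp only
    by_cases hw : ∑ i ∈ s, X i w ∈ Set.Icc (-t) t
    · rw [Set.indicator_of_mem (by exact hw)]; simp
    · rw [Set.indicator_of_notMem (by exact hw)]
      by_contra hlt
      push Not at hlt
      exact hw (abs_le.1 (by linarith))
  rw [integral_sub (integrable_const _) ((integrable_const _).indicator hm),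
    integral_indicator_const _ hm] at h2
  simp only [integral_const, probReal_univ, smul_eq_mul, one_mul] at h2
  have : r / (16 * D) = t / 2 := by rw [ht]; field_simp; norm_num
  rw [this]
  nlinarith

/-- Young's inequality `y²m ≤ (2y³ + m³)/3` integrated with `m` the mean of `|X i|`, followed by
Jensen's inequality for the cube. -/
theorem integral_sq_mul_integral_abs_le (h : IsCenteredFamily X P) (i : ι) :
    (∫ w, X i w ^ 2 ∂P) * ∫ w, |X i w| ∂P ≤ ∫ w, |X i w| ^ 3 ∂P := by
  set m := ∫ w, |X i w| ∂P with hm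
  have hm0 : 0 ≤ m := integral_nonneg fun w => abs_nonneg _
  have hd : Integrable (fun w => |X i w| - m) P := (h.integrable i).abs.sub (integrable_const _)
  have hd' : Integrable (fun w => 3 * m ^ 2 * (|X i w| - m)) P := hd.const_mul _
  have h1 : m ^ 3 ≤ ∫ w, |X i w| ^ 3 ∂P := by
    have h2 : ∫ w, (m ^ 3 + 3 * m ^ 2 * (|X i w| - m)) ∂P = m ^ 3 := by
      rw [integral_add (integrable_const _) hd', integral_const_mul, integral_sub (h.integrable i).abs (integrable_const _), ← hm]
      simp
    rw [← h2]
    refine integral_mono ((integrable_const _).add hd') (h.integrable_abs_cube i)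
      fun w => ?_
    dsimp only
    nlinarith [mul_nonneg (add_nonneg (abs_nonneg (X i w)) (mul_nonneg zero_le_two hm0))
      (sq_nonneg (|X i w| - m))]
  have h3 : ∫ w, X i w ^ 2 * m ∂P ≤ ∫ w, (2 * |X i w| ^ 3 + m ^ 3) / 3 ∂P := by
    refine integral_mono ((h.integrable_sq i).mul_const _)
      ((((h.integrable_abs_cube i).const_mul _).add (integrable_const _)).div_const _) fun w => ?_
    dsimp only
    rw [← sq_abs (X i w)]
    nlinarith [mul_nonneg (add_nonneg (mul_nonneg zero_le_two (abs_nonneg (X i w))) hm0)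
      (sq_nonneg (|X i w| - m))]
  rw [integral_mul_const, integral_div, integral_add ((h.integrable_abs_cube i).const_mul _)
    (integrable_const _), integral_const_mul] at h3
  simp only [integral_const, probReal_univ, smul_eq_mul, one_mul] at h3
  linarith

end IsCenteredFamily

/-- The clipped function is close to `a` times the sign of `x - x₀`: the truncation zone costs at
most `a²`, and the shift by `x₀` costs `2a|x₀|`. -/
theorem sub_le_mul_clip {a x x₀ : ℝ} (ha : 0 ≤ a) :
    a * (|x| - 2 * |x₀| - a) ≤ x * clip a (x - x₀) := by
  have h1 : a * |x - x₀| - a ^ 2 ≤ (x - x₀) * clip a (x - x₀) := by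
    rcases le_total |x - x₀| a with h | h
    · rw [clip_of_abs_le h, ← sq, ← sq_abs (x - x₀)]
      nlinarith [abs_nonneg (x - x₀)]
    · rcases le_total 0 (x - x₀) with h' | h'
      · rw [abs_of_nonneg h'] at *
        rw [clip_of_le ha h]; nlinarith
      · rw [abs_of_nonpos h'] at *
        rw [clip_of_le_neg ha (by linarith)]; nlinarith
  have h2 : -(|x₀| * a) ≤ x₀ * clip a (x - x₀) := by
    refine neg_le_of_abs_le ?_
    rw [abs_mul]
    exact mul_le_mul_of_nonneg_left (abs_clip_le ha _) (abs_nonneg _)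
  have h3 : a * |x| ≤ a * (|x - x₀| + |x₀|) := by
    refine mul_le_mul_of_nonneg_left ?_ ha
    simpa using abs_add_le (x - x₀) x₀
  nlinarith

namespace IsCenteredFamily

variable {ι Ω : Type*} [MeasurableSpace Ω] {P : Measure Ω} [IsProbabilityMeasure P]
  {X : ι → Ω → ℝ} [DecidableEq ι]

/-- A lower bound for the probability of an interval near the mean, on scales above a constant. -/
theorem le_measureReal_abs_sum_sub_le (h : IsCenteredFamily X P) (s : Finset ι)
    {K D r a x₀ : ℝ} (hK : 1 ≤ K) (hD : D = 16 * K ^ 2)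
    (hV : ∑ i ∈ s, ∫ w, X i w ^ 2 ∂P = r ^ 2) (hr : 4 * D ≤ r)
    (h3 : ∑ i ∈ s, ∫ w, |X i w| ^ 3 ∂P ≤ K * r ^ 2)
    (ha : 512 * D ^ 2 * K ≤ a) (har : 2 * |x₀| + a ≤ r / (32 * D)) :
    a / (64 * D * r) ≤ P.real {w | |∑ i ∈ s, X i w - x₀| ≤ a} := by
  have hKK : 1 ≤ K ^ 2 := one_le_pow₀ hK
  have hD1 : 16 ≤ D := by rw [hD]; linarith
  have hr0 : 0 < r := by linarith
  have ha0 : 0 ≤ a := le_trans (by positivity) ha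
  have hsq : √(∑ i ∈ s, ∫ w, X i w ^ 2 ∂P) = r := by rw [hV, Real.sqrt_sq hr0.le]
  have hbig : 64 * K ^ 2 ≤ ∑ i ∈ s, ∫ w, X i w ^ 2 ∂P := by rw [hV]; nlinarith
  rw [← hV] at h3
  have hc : ∀ c d : ℝ, c ≤ d →
      P.real {w | ∑ i ∈ s, X i w ∈ Set.Icc c d} ≤ D * (d - c + 1) / r := fun c d hcd => by
    have := h.measureReal_sum_mem_Icc_le_of_le s hK (by linarith) h3 hcd
    rwa [hsq, ← hD] at this
  have hce : ∀ i ∈ s, ∀ c d : ℝ, c ≤ d →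
      P.real {w | ∑ j ∈ s.erase i, X j w ∈ Set.Icc c d} ≤ D * (d - c + 1) / r :=
    fun i hi c d hcd => by
      have := h.measureReal_sum_erase_mem_Icc_le hK hbig h3 hi hcd
      rwa [hsq, ← hD] at this
  have habs := h.le_integral_abs_sum s (by linarith) hr hc
  set p := P.real {w | |∑ i ∈ s, X i w - x₀| ≤ a} with hp
  have hstein := h.integral_sum_mul s (measurable_clip_sub a x₀) fun x => abs_clip_le ha0 (x - x₀)
  -- Here the exchange formula is read the other way: its left side is of order `a r`, while its
  -- right side will be at most `r² p` plus an error of order `r`.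
  have hlow : a * (r / (16 * D) - 2 * |x₀| - a) ≤
      ∫ w, (∑ i ∈ s, X i w) * clip a (∑ i ∈ s, X i w - x₀) ∂P := by
    have h5 : ∫ w, a * (|∑ i ∈ s, X i w| - (2 * |x₀| + a)) ∂P
        = a * ((∫ w, |∑ i ∈ s, X i w| ∂P) - (2 * |x₀| + a)) := by
      rw [integral_const_mul, integral_sub (h.integrable_sum s).abs (integrable_const _)]
      simp
    refine le_trans ?_ (h5.symm.le.trans (integral_mono
      (((h.integrable_sum s).abs.sub (integrable_const _)).const_mul a)
      ((h.integrable_sum s).mul_bdd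
        ((measurable_clip_sub a x₀).comp (h.measurable_sum s)).aestronglyMeasurable
        (.of_forall fun w => abs_clip_le ha0 _)) fun w => ?_))
    · refine mul_le_mul_of_nonneg_left ?_ ha0
      linarith
    · have := sub_le_mul_clip (x := ∑ i ∈ s, X i w) (x₀ := x₀) ha0
      dsimp only
      rwa [← sub_sub]
  have hterm : ∀ i ∈ s, ∫ w, X i w * (clip a (∑ j ∈ s.erase i, X j w + X i w - x₀)
        - clip a (∑ j ∈ s.erase i, X j w - x₀)) ∂P ≤
      (∫ w, X i w ^ 2 ∂P) * p
        + 2 * D / r * (2 * (∫ w, |X i w| ^ 3 ∂P) + 2 * ∫ w, X i w ^ 2 ∂P) := by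
    intro i hi
    have hYm := h.measurable_sum (s.erase i)
    have hind := h.indepFun_sum_erase s i
    set Y : Ω → ℝ := fun w => ∑ j ∈ s.erase i, X j w with hY
    set κ : ℝ → ℝ := fun z => 2 * D / r * (|z| + 1) with hκ
    have hκm : Measurable κ := (measurable_norm.add_const 1).const_mul _
    have hκX : Integrable (fun w => κ (X i w)) P :=
      ((h.integrable i).abs.add (integrable_const _)).const_mul _
    have hκX2 : Integrable (fun w => X i w ^ 2 * κ (X i w)) P := by
      have : (fun w => X i w ^ 2 * κ (X i w))
          = fun w => 2 * D / r * (|X i w| ^ 3 + X i w ^ 2) := by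
        ext w
        rw [hκ, ← sq_abs (X i w)]; ring
      rw [this]
      exact ((h.integrable_abs_cube i).add (h.integrable_sq i)).const_mul _
    have hslab : ∀ c d : ℝ, c ≤ d → ∀ A : Set ℝ,
        (∀ y ∈ A, c ≤ |y - x₀| ∧ |y - x₀| ≤ d) →
        P.real {w | Y w ∈ A} ≤ 2 * D / r * (d - c + 1) := by
      intro c d hcd A hA
      have hsub : {w | Y w ∈ A} ⊆ {w | Y w ∈ Set.Icc (x₀ + c) (x₀ + d)} ∪
          {w | Y w ∈ Set.Icc (x₀ - d) (x₀ - c)} := by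
        intro w hw
        obtain ⟨h1, h2⟩ := hA _ hw
        obtain ⟨h4, h5⟩ := abs_le.1 h2
        rcases le_abs.1 h1 with h6 | h6
        · exact Or.inl ⟨by linarith, by linarith⟩
        · exact Or.inr ⟨by linarith, by linarith⟩
      refine (measureReal_mono hsub).trans ((measureReal_union_le _ _).trans ?_)
      have h7 := hce i hi (x₀ + c) (x₀ + d) (by linarith)
      have h8 := hce i hi (x₀ - d) (x₀ - c) (by linarith)
      refine (add_le_add h7 h8).trans (le_of_eq ?_)
      ring
    -- `A₁` and `A₂` are the shells of width `|X i|` just outside and just inside the window. `A₁`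
    -- carries the increments of the test function when `Y` is outside the window; `A₂` is where `Y`
    -- can lie in the window while the full sum does not.
    set A₁ : Set (ℝ × ℝ) := {q | a < |q.2 - x₀| ∧ |q.2 - x₀| ≤ a + |q.1|}
    set A₂ : Set (ℝ × ℝ) := {q | a - |q.1| ≤ |q.2 - x₀| ∧ |q.2 - x₀| ≤ a}
    have hd : Measurable fun q : ℝ × ℝ => |q.2 - x₀| := by fun_prop
    have hz : Measurable fun q : ℝ × ℝ => |q.1| := by fun_prop
    have hA1 : MeasurableSet A₁ :=
      (measurableSet_lt measurable_const hd).inter (measurableSet_le hd (hz.const_add a))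
    have hA2 : MeasurableSet A₂ :=
      (measurableSet_le (hz.const_sub a) hd).inter (measurableSet_le hd measurable_const)
    have hF1 := integral_mul_indicator_le_of_indepFun (h.measurable i) hYm hind
      (φ := fun z => z ^ 2) (by fun_prop) (fun z => sq_nonneg z) hκm hA1 (fun z => by
        refine (hslab a (a + |z|) (by linarith [abs_nonneg z])
          {y | a < |y - x₀| ∧ |y - x₀| ≤ a + |z|} fun y hy => ⟨hy.1.le, hy.2⟩).trans_eq ?_
        simp [hκ]) (h.integrable_sq i) hκX2
    have hF2 := integral_mul_indicator_le_of_indepFun (h.measurable i) hYm hind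
      (φ := fun _ => 1) (by fun_prop) (fun z => zero_le_one) hκm hA2 (fun z => by
        refine (hslab (a - |z|) a (by linarith [abs_nonneg z])
          {y | a - |z| ≤ |y - x₀| ∧ |y - x₀| ≤ a} fun y hy => hy).trans_eq ?_
        simp [hκ]) (integrable_const _) (by simpa using hκX)
    set J : Set ℝ := {y | |y - x₀| ≤ a} with hJ
    have hJm : MeasurableSet J := measurableSet_le (by fun_prop) measurable_const
    have hJY : MeasurableSet {w | Y w ∈ J} := hYm hJm
    have hJX : MeasurableSet {w | |∑ i ∈ s, X i w - x₀| ≤ a} := h.measurable_sum s hJm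
    have hind2 : ∫ w, X i w ^ 2 * {w | Y w ∈ J}.indicator 1 w ∂P
        = (∫ w, X i w ^ 2 ∂P) * P.real {w | Y w ∈ J} := by
      have h1 : IndepFun (fun w => X i w ^ 2) (fun w => J.indicator (1 : ℝ → ℝ) (Y w)) P :=
        hind.comp (φ := fun z => z ^ 2) (by fun_prop) (measurable_one.indicator hJm)
      have h2 := h1.integral_fun_mul_eq_mul_integral
        ((h.measurable i).pow_const 2).aestronglyMeasurable
        ((measurable_one.indicator hJm).comp hYm).aestronglyMeasurable
      rw [← integral_indicator_one hJY]
      exact h2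
    have hpY : P.real {w | Y w ∈ J} ≤ p + 2 * D / r * ((∫ w, |X i w| ∂P) + 1) := by
      have h1 : ∫ w, {w | Y w ∈ J}.indicator (1 : Ω → ℝ) w ∂P ≤
          ∫ w, ({w | |∑ i ∈ s, X i w - x₀| ≤ a}.indicator (1 : Ω → ℝ) w + 1 *
            A₂.indicator 1 (X i w, Y w)) ∂P := by
        refine integral_mono ((integrable_const _).indicator hJY)
          (((integrable_const _).indicator hJX).add ?_) fun w => ?_
        · simp_rw [one_mul]
          exact (integrable_const (1 : ℝ)).indicator ((h.measurable i).prodMk hYm hA2)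
        · dsimp only
          have hnn : 0 ≤ {w | |∑ i ∈ s, X i w - x₀| ≤ a}.indicator (1 : Ω → ℝ) w :=
            Set.indicator_nonneg (fun _ _ => zero_le_one) _
          have hnn' : 0 ≤ A₂.indicator
              (1 : ℝ × ℝ → ℝ) (X i w, Y w) :=
            Set.indicator_nonneg (fun _ _ => zero_le_one) _
          by_cases hw : Y w ∈ J
          · rw [Set.indicator_of_mem (show w ∈ {w | Y w ∈ J} from hw)]
            by_cases hw2 : |∑ i ∈ s, X i w - x₀| ≤ a
            · rw [Set.indicator_of_mem (show w ∈ {w | |∑ i ∈ s, X i w - x₀| ≤ a} from hw2)]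
              simp only [Pi.one_apply]; linarith
            · have hmem : (X i w, Y w) ∈
                  A₂ := by
                refine ⟨?_, hw⟩
                have h9 : Y w = ∑ j ∈ s, X j w - X i w := sum_erase_eq hi w
                have h10 := abs_add_le (Y w - x₀) (X i w)
                rw [h9] at h10 ⊢
                have h11 : ∑ j ∈ s, X j w - X i w - x₀ + X i w = ∑ j ∈ s, X j w - x₀ := by ring
                rw [h11] at h10
                push Not at hw2
                dsimp only
                linarith
              rw [Set.indicator_of_mem hmem]
              simp only [Pi.one_apply]; linarith
          · rw [Set.indicator_of_notMem (show w ∉ {w | Y w ∈ J} from hw)]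
            linarith
      rw [integral_indicator_one hJY, integral_add ((integrable_const _).indicator hJX),
        integral_indicator_one hJX] at h1
      · have h2 : ∫ w, 1 * κ (X i w) ∂P = 2 * D / r * ((∫ w, |X i w| ∂P) + 1) := by
          simp_rw [one_mul, hκ]
          rw [integral_const_mul, integral_add (h.integrable i).abs (integrable_const _)]
          simp
        rw [h2] at hF2
        linarith
      · simp_rw [one_mul]
        exact (integrable_const (1 : ℝ)).indicator ((h.measurable i).prodMk hYm hA2)
    have hF1' : ∫ w, X i w ^ 2 * κ (X i w) ∂P
        = 2 * D / r * ((∫ w, |X i w| ^ 3 ∂P) + ∫ w, X i w ^ 2 ∂P) := by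
      rw [← integral_add (h.integrable_abs_cube i) (h.integrable_sq i), ← integral_const_mul]
      congr 1
      ext w
      rw [hκ, ← sq_abs (X i w)]; ring
    have hi1 : Integrable (fun w => X i w ^ 2 * {w | Y w ∈ J}.indicator 1 w) P := by
      have := (h.integrable_sq i).indicator hJY
      refine this.congr (.of_forall fun w => ?_)
      by_cases hw : Y w ∈ J <;> simp [hw]
    have hi2 : Integrable (fun w => X i w ^ 2 *
        A₁.indicator 1 (X i w, Y w)) P := by
      have := (h.integrable_sq i).indicator ((h.measurable i).prodMk hYm hA1)
      refine this.congr (.of_forall fun w => ?_)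
      change ((fun w => (X i w, Y w)) ⁻¹' A₁).indicator _ w = X i w ^ 2 * A₁.indicator 1 (X i w, Y w)
      by_cases hw : (X i w, Y w) ∈ A₁
      · rw [Set.indicator_of_mem hw, Set.indicator_of_mem (show w ∈ (fun w => (X i w, Y w)) ⁻¹' A₁ from hw)]; simp
      · rw [Set.indicator_of_notMem hw, Set.indicator_of_notMem (show w ∉ (fun w => (X i w, Y w)) ⁻¹' A₁ from hw)]; simp
    have hmain : ∫ w, X i w * (clip a (Y w + X i w - x₀) - clip a (Y w - x₀)) ∂P ≤
        ∫ w, (X i w ^ 2 * {w | Y w ∈ J}.indicator 1 w + X i w ^ 2 *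
        A₁.indicator 1 (X i w, Y w)) ∂P := by
      refine integral_mono ?_ (hi1.add hi2) fun w => ?_
      · refine h.integrable_mul_bdd i (B := a + a) ?_ fun w => ?_
        · exact ((measurable_clip_sub a x₀).comp (hYm.add (h.measurable i))).sub
            ((measurable_clip_sub a x₀).comp hYm)
        · exact (abs_sub _ _).trans (add_le_add (abs_clip_le ha0 _) (abs_clip_le ha0 _))
      · dsimp only
        have h1 := mul_clip_sub_clip_le (L := a) (x := Y w - x₀) (z := X i w) ha0
        rw [show Y w - x₀ + X i w = Y w + X i w - x₀ by ring] at h1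
        refine h1.trans ?_
        by_cases hw : |Y w - x₀| ≤ a
        · have : |Y w - x₀| ≤ a + |X i w| := hw.trans (by linarith [abs_nonneg (X i w)])
          rw [if_pos this, Set.indicator_of_mem (show w ∈ {w | Y w ∈ J} from hw),
            Set.indicator_of_notMem (fun hh => absurd hw (not_le.2 hh.1))]
          simp
        · rw [Set.indicator_of_notMem (show w ∉ {w | Y w ∈ J} from hw)]
          push Not at hw
          split_ifs with h12
          · rw [Set.indicator_of_mem (show (X i w, Y w) ∈ A₁ from ⟨hw, h12⟩)]; simp
          · rw [Set.indicator_of_notMem fun hh => h12 hh.2]; simp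
    rw [integral_add hi1 hi2, hind2] at hmain
    have hsm := h.integral_sq_mul_integral_abs_le i
    have hσ0 : 0 ≤ ∫ w, X i w ^ 2 ∂P := integral_nonneg fun w => sq_nonneg _
    have hDr : 0 ≤ 2 * D / r := by positivity
    have h13 := mul_le_mul_of_nonneg_left hpY hσ0
    have h14 := mul_le_mul_of_nonneg_left hsm hDr
    rw [hF1'] at hF1
    linarith
  have hsum := Finset.sum_le_sum hterm
  rw [← hstein, Finset.sum_add_distrib, ← Finset.sum_mul, ← Finset.mul_sum,
    Finset.sum_add_distrib, ← Finset.mul_sum, ← Finset.mul_sum, hV] at hsum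
  have hup : 2 * D / r * (2 * ∑ i ∈ s, ∫ w, |X i w| ^ 3 ∂P + 2 * r ^ 2) ≤ a * r / (64 * D) := by
    rw [hV] at h3
    have : 2 * D / r * (2 * ∑ i ∈ s, ∫ w, |X i w| ^ 3 ∂P + 2 * r ^ 2) ≤ 8 * D * K * r := by
      rw [div_mul_eq_mul_div, div_le_iff₀ hr0]
      nlinarith [mul_nonneg (mul_nonneg (by linarith : 0 ≤ D) (by linarith : 0 ≤ K - 1)) (sq_nonneg r)]
    refine this.trans ?_
    rw [le_div_iff₀ (by positivity)]
    nlinarith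
  have h20 : a * (r / (32 * D)) ≤ a * (r / (16 * D) - 2 * |x₀| - a) := by
    refine mul_le_mul_of_nonneg_left ?_ ha0
    have : r / (16 * D) = r / (32 * D) + r / (32 * D) := by field_simp; norm_num
    linarith
  have h21 : a * r / (64 * D) ≤ r ^ 2 * p := by
    have : a * (r / (32 * D)) = a * r / (64 * D) + a * r / (64 * D) := by field_simp; ring
    linarith
  rw [div_le_iff₀ (by positivity)]
  rw [div_le_iff₀ (by positivity)] at h21
  nlinarith

end IsCenteredFamily

/-! ### Expectation of `gFun` of a centered sum. -/

theorem measurable_gFun (α : ℝ) : Measurable (gFun α) := by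
  unfold gFun; fun_prop

theorem gFun_nonneg (α x : ℝ) : 0 ≤ gFun α x := (Real.exp_pos _).le

theorem gFun_le_one {α : ℝ} (h : α ∈ Set.Ioo (0 : ℝ) 1) (x : ℝ) : gFun α x ≤ 1 := by
  refine Real.exp_le_one_iff.2 ?_
  rcases le_total 0 x with hx | hx
  · exact (min_le_right _ _).trans (mul_nonpos_of_nonpos_of_nonneg (by linarith [h.2]) hx)
  · exact (min_le_left _ _).trans (mul_nonpos_of_nonneg_of_nonpos h.1.le hx)

theorem integrable_gFun_comp {Ω : Type*} [MeasurableSpace Ω] {P : Measure Ω} [IsFiniteMeasure P]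
    {Y : Ω → ℝ} (hY : AEMeasurable Y P) {α : ℝ} (hα : α ∈ Set.Ioo (0 : ℝ) 1) :
    Integrable (fun w => gFun α (Y w)) P :=
  Integrable.of_bound ((measurable_gFun α).comp_aemeasurable hY).aestronglyMeasurable 1
    (.of_forall fun w => by
      rw [Real.norm_eq_abs, abs_of_nonneg (gFun_nonneg _ _)]; exact gFun_le_one hα _)

/-- A linear bound on the concentration function of `Y` bounds the expectation of `gFun α Y`. -/
theorem integral_gFun_le {Ω : Type*} [MeasurableSpace Ω] {P : Measure Ω} [IsProbabilityMeasure P]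
    {Y : Ω → ℝ} (hY : Measurable Y) {α : ℝ} (hα : α ∈ Set.Ioo (0 : ℝ) 1) {B : ℝ}
    (hc : ∀ a b : ℝ, a ≤ b → P.real {w | Y w ∈ Set.Icc a b} ≤ B * (b - a + 1)) :
    ∫ w, gFun α (Y w) ∂P ≤ B * (1 / ((1 - α) * α) + 1) := by
  obtain ⟨h0, h1⟩ := hα
  have h1' : 0 < 1 - α := by linarith
  -- Layer cake: for `t ≤ 1` the superlevel set of `gFun` lies in an interval of length `-log t *
  -- W`, since `1/α + 1/(1-α) = W`, and `-log` has integral 1 over `(0, 1]`.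
  rw [(integrable_gFun_comp hY.aemeasurable ⟨h0, h1⟩).integral_eq_integral_meas_lt
    (.of_forall fun w => gFun_nonneg _ _)]
  set W := 1 / ((1 - α) * α) with hW
  have hlog : IntegrableOn Real.log (Set.Ioc 0 1) volume :=
    (intervalIntegrable_iff_integrableOn_Ioc_of_le zero_le_one).1 intervalIntegral.intervalIntegrable_log'
  have hint : IntegrableOn (fun t => B * (-Real.log t * W + 1)) (Set.Ioc 0 1) volume :=
    ((hlog.neg.mul_const W).add (integrableOn_const (by simp))).const_mul B
  have hval : ∫ t in Set.Ioc (0 : ℝ) 1, B * (-Real.log t * W + 1) = B * (W + 1) := by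
    have hlog1 : ∫ t in Set.Ioc (0 : ℝ) 1, Real.log t = -1 := by
      rw [← intervalIntegral.integral_of_le zero_le_one, integral_log]; simp
    have hn : IntegrableOn (fun t => -Real.log t * W) (Set.Ioc 0 1) volume := hlog.neg.mul_const W
    rw [integral_const_mul, integral_add hn (integrableOn_const (by simp)),
      integral_mul_const, integral_neg, hlog1]
    simp
  rw [← hval]
  have hpt : ∀ t ∈ Set.Ioi (0 : ℝ), P.real {w | t < gFun α (Y w)} ≤
      (Set.Ioc (0 : ℝ) 1).indicator (fun t => B * (-Real.log t * W + 1)) t := by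
    intro t ht
    by_cases ht1 : t ≤ 1
    · rw [Set.indicator_of_mem (show t ∈ Set.Ioc (0 : ℝ) 1 from ⟨ht, ht1⟩)]
      have hlt : Real.log t ≤ 0 := Real.log_nonpos (le_of_lt ht) ht1
      have hsub : {w | t < gFun α (Y w)} ⊆
          {w | Y w ∈ Set.Icc (Real.log t / α) (-Real.log t / (1 - α))} := by
        intro w hw
        have h2 := Real.log_lt_log ht hw
        rw [gFun, Real.log_exp, lt_min_iff] at h2
        constructor
        · rw [div_le_iff₀ h0]; linarith
        · rw [le_div_iff₀ h1']; linarith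
      refine (measureReal_mono hsub).trans ((hc _ _ ?_).trans_eq ?_)
      · exact (div_nonpos_of_nonpos_of_nonneg hlt h0.le).trans (div_nonneg (by linarith) h1'.le)
      · rw [hW]; field_simp; ring
    · rw [Set.indicator_of_notMem (fun h => ht1 h.2)]
      have : {w | t < gFun α (Y w)} = ∅ := by
        ext w
        simpa using (gFun_le_one ⟨h0, h1⟩ (Y w)).trans (le_of_not_ge ht1)
      rw [this]; simp
  calc ∫ t in Set.Ioi (0 : ℝ), P.real {w | t < gFun α (Y w)}
      ≤ ∫ t in Set.Ioi (0 : ℝ), (Set.Ioc (0 : ℝ) 1).indicator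
          (fun t => B * (-Real.log t * W + 1)) t := by
        refine integral_mono_of_nonneg (.of_forall fun t => measureReal_nonneg) ?_ ?_
        · exact ((integrable_indicator_iff measurableSet_Ioc).2 hint).integrableOn
        · exact (ae_restrict_iff' measurableSet_Ioi).2 (.of_forall hpt)
    _ = _ := by
        rw [setIntegral_indicator measurableSet_Ioc,
          Set.inter_eq_self_of_subset_right Set.Ioc_subset_Ioi_self]

/-- Two-sided bounds for the expectation of `gFun` of a centered sum. -/
theorem exists_bounds_integral_gFun (C : ℝ) : ∃ C₂ C₃ C₄ : ℝ, 0 < C₂ ∧ 0 < C₃ ∧ 0 < C₄ ∧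
    ∀ {ι : Type} {Ω : Type u} [Fintype ι] [MeasurableSpace Ω] (P : Measure Ω) [IsProbabilityMeasure P]
      (X : ι → Ω → ℝ) (r α : ℝ), IsCenteredFamily X P → 0 < r → α ∈ Set.Ioo (0 : ℝ) 1 →
      ∑ i, ∫ w, X i w ^ 2 ∂P = r ^ 2 → ∑ i, ∫ w, |X i w| ^ 3 ∂P ≤ C * r ^ 2 →
      ∫ w, gFun α (∑ i, X i w) ∂P ≤ C₂ / (r * (1 - α) * α) ∧
      (C₃ ≤ r * (1 - α) * α → C₄ / (r * (1 - α) * α) ≤ ∫ w, gFun α (∑ i, X i w) ∂P) := by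
  classical
  set K := max C 1 with hK
  have hK1 : 1 ≤ K := le_max_right _ _
  have hKK : 1 ≤ K ^ 2 := one_le_pow₀ hK1
  set D := 16 * K ^ 2 with hD
  have hD1 : 16 ≤ D := by linarith
  set M := 512 * D ^ 2 * K with hM
  have hM0 : 1 ≤ M := by
    have : 1 ≤ D ^ 2 := one_le_pow₀ (by linarith)
    nlinarith
  -- `M` is the smallest window size admitted by the lower bound. The second constant gives `3a ≤ r
  -- / (32D)` for `a = M / ((1-α)α)`; the third is the minimum of `gFun` on the window times the
  -- constant in the window's probability.
  refine ⟨2 * D, 96 * D * M, Real.exp (-(4 * M)) * (M / (64 * D)), by positivity, by positivity,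
    by positivity, ?_⟩
  intro ι Ω _ _ P _ X r α h hr hα hV h3
  obtain ⟨h0, h1⟩ := hα
  have h1' : 0 < 1 - α := by linarith
  have hq : 0 < (1 - α) * α := mul_pos h1' h0
  have hq4 : (1 - α) * α ≤ 1 / 4 := by nlinarith [sq_nonneg (α - 1 / 2)]
  have h3' : ∑ i, ∫ w, |X i w| ^ 3 ∂P ≤ K * r ^ 2 :=
    h3.trans (mul_le_mul_of_nonneg_right (le_max_left _ _) (sq_nonneg _))
  constructor
  · have hc := integral_gFun_le (P := P) (h.measurable_sum Finset.univ) ⟨h0, h1⟩ (B := D / r)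
      fun a b hab => by
        have := h.measureReal_sum_mem_Icc_le_of_le Finset.univ hK1 (by rw [hV]; positivity)
          (by rw [hV]; exact h3') hab
        rw [hV, Real.sqrt_sq hr.le] at this
        refine this.trans_eq ?_
        ring
    refine hc.trans ?_
    rw [mul_assoc, div_mul_eq_mul_div, le_div_iff₀ (by positivity), div_mul_eq_mul_div,
      div_le_iff₀ hr]
    have : D * (1 / ((1 - α) * α) + 1) * (r * ((1 - α) * α)) = D * r * (1 + (1 - α) * α) := by
      field_simp
    rw [this]
    have : 0 < D * r := by positivity
    nlinarith
  · intro hC3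
    set W := 1 / ((1 - α) * α) with hW
    have hW1 : 1 ≤ W := by rw [hW, le_div_iff₀ hq]; linarith
    have hrW : 96 * D * M * W ≤ r := by
      rw [hW, mul_one_div, div_le_iff₀ hq]; linarith
    set a := M * W with ha
    have haM : M ≤ a := le_mul_of_one_le_right (by linarith) hW1
    have ha0 : 0 < a := by linarith
    have har : 3 * a ≤ r / (32 * D) := by
      rw [le_div_iff₀ (by positivity), ha]; linarith
    have hr4 : 4 * D ≤ r := by
      rw [le_div_iff₀ (by positivity)] at har
      nlinarith
    -- The window has one end at 0 and lies on the side where `gFun` decays slowly, at rate `min(α,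
    -- 1-α)`. There this rate times the length `2a` is at most `4M`, uniformly in `α`.
    obtain ⟨x₀, hx₀, hx₀g⟩ : ∃ x₀ : ℝ, |x₀| = a ∧
        ∀ x : ℝ, |x - x₀| ≤ a → Real.exp (-(4 * M)) ≤ gFun α x := by
      rcases le_total α (1 / 2) with hα2 | hα2
      · refine ⟨-a, by rw [abs_neg, abs_of_pos ha0], fun x hx => ?_⟩
        obtain ⟨h5, h6⟩ := abs_le.1 hx
        have hαa : α * a ≤ 2 * M := by
          rw [ha, hW, mul_one_div, mul_div_assoc', div_le_iff₀ hq]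
          have := mul_pos (by linarith : 0 < M) h0
          nlinarith
        refine Real.exp_le_exp.2 (le_min ?_ ?_) <;> nlinarith
      · refine ⟨a, abs_of_pos ha0, fun x hx => ?_⟩
        obtain ⟨h5, h6⟩ := abs_le.1 hx
        have hαa : (1 - α) * a ≤ 2 * M := by
          rw [ha, hW, mul_one_div, mul_div_assoc', div_le_iff₀ hq]
          have := mul_pos (by linarith : 0 < M) h1'
          nlinarith
        refine Real.exp_le_exp.2 (le_min ?_ ?_) <;> nlinarith
    have hp := h.le_measureReal_abs_sum_sub_le Finset.univ hK1 hD hV hr4 h3' haM (x₀ := x₀)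
      (by rw [hx₀]; linarith)
    have hm : MeasurableSet {w | |∑ i, X i w - x₀| ≤ a} :=
      measurableSet_le ((h.measurable_sum Finset.univ).sub_const x₀).norm measurable_const
    calc Real.exp (-(4 * M)) * (M / (64 * D)) / (r * (1 - α) * α)
        = a / (64 * D * r) * Real.exp (-(4 * M)) := by rw [ha, hW]; field_simp
      _ ≤ P.real {w | |∑ i, X i w - x₀| ≤ a} * Real.exp (-(4 * M)) := by gcongr
      _ = ∫ w, {w | |∑ i, X i w - x₀| ≤ a}.indicator (fun _ => Real.exp (-(4 * M))) w ∂P := by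
          rw [integral_indicator_const _ hm, smul_eq_mul]
      _ ≤ ∫ w, gFun α (∑ i, X i w) ∂P := by
          refine integral_mono ((integrable_const _).indicator hm)
            (integrable_gFun_comp (h.measurable_sum Finset.univ).aemeasurable ⟨h0, h1⟩)
            fun w => ?_
          by_cases hw : |∑ i, X i w - x₀| ≤ a
          · rw [Set.indicator_of_mem (show w ∈ {w | |∑ i, X i w - x₀| ≤ a} from hw)]
            exact hx₀g _ hw
          · rw [Set.indicator_of_notMem (show w ∉ {w | |∑ i, X i w - x₀| ≤ a} from hw)]
            exact gFun_nonneg _ _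

/-! ### Geometric means of densities as exponential tilts. -/

section Density

variable {𝒳 : Type u} [MeasurableSpace 𝒳] {ν : Measure 𝒳} {f g : 𝒳 → ℝ}

theorem IsDensity.integrable (hf : IsDensity ν f) : Integrable f ν := by
  by_contra h
  have := hf.integral_eq_one
  rw [integral_undef h] at this
  exact zero_ne_one this

theorem IsDensity.isProbabilityMeasure (hf : IsDensity ν f) :
    IsProbabilityMeasure (densityMeasure ν f) := by
  refine ⟨?_⟩
  rw [densityMeasure, withDensity_apply _ MeasurableSet.univ, Measure.restrict_univ,
    ← ofReal_integral_eq_lintegral_ofReal hf.integrable (.of_forall hf.nonneg), hf.integral_eq_one,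
    ENNReal.ofReal_one]

theorem integral_densityMeasure (hf : Measurable f) (hf0 : ∀ x, 0 ≤ f x) (h : 𝒳 → ℝ) :
    ∫ x, h x ∂(densityMeasure ν f) = ∫ x, f x * h x ∂ν := by
  rw [densityMeasure, integral_withDensity_eq_integral_toReal_smul hf.ennreal_ofReal
    (.of_forall fun x => ENNReal.ofReal_lt_top)]
  simp [ENNReal.toReal_ofReal (hf0 _)]

theorem integrable_densityMeasure_iff (hf : Measurable f) (hf0 : ∀ x, 0 ≤ f x) (h : 𝒳 → ℝ) :
    Integrable h (densityMeasure ν f) ↔ Integrable (fun x => f x * h x) ν := by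
  rw [densityMeasure, integrable_withDensity_iff_integrable_smul' hf.ennreal_ofReal
    (.of_forall fun x => ENNReal.ofReal_lt_top)]
  simp [ENNReal.toReal_ofReal (hf0 _)]

theorem ae_densityMeasure_iff (hf : Measurable f) {p : 𝒳 → Prop} :
    (∀ᵐ x ∂(densityMeasure ν f), p x) ↔ ∀ᵐ x ∂ν, 0 < f x → p x := by
  rw [densityMeasure, ae_withDensity_iff hf.ennreal_ofReal]
  simp [ENNReal.ofReal_eq_zero]

/-- The weighted geometric mean `f^(1-α) g^α` of two functions. -/
noncomputable def geomMean (f g : 𝒳 → ℝ) (α : ℝ) (x : 𝒳) : ℝ := f x ^ (1 - α) * g x ^ α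

theorem measurable_geomMean (hf : Measurable f) (hg : Measurable g) (α : ℝ) :
    Measurable (geomMean f g α) :=
  (hf.pow_const _).mul (hg.pow_const _)

theorem geomMean_nonneg (hf : ∀ x, 0 ≤ f x) (hg : ∀ x, 0 ≤ g x) (α : ℝ) (x : 𝒳) :
    0 ≤ geomMean f g α x :=
  mul_nonneg (Real.rpow_nonneg (hf x) _) (Real.rpow_nonneg (hg x) _)

theorem geomMean_le (hf : ∀ x, 0 ≤ f x) (hg : ∀ x, 0 ≤ g x) {α : ℝ} (hα : α ∈ Set.Icc (0 : ℝ) 1)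
    (x : 𝒳) : geomMean f g α x ≤ f x + g x := by
  refine (Real.geom_mean_le_arith_mean2_weighted (by linarith [hα.2]) hα.1 (hf x) (hg x)
    (by ring)).trans ?_
  nlinarith [hf x, hg x, hα.1, hα.2]

theorem geomMean_of_pos {x : 𝒳} (hf : 0 < f x) (hg : 0 < g x) (α : ℝ) :
    geomMean f g α x = f x * Real.exp (-(α * logRatio f g x)) := by
  have h : f x * Real.exp (-(α * logRatio f g x)) =
      Real.exp (Real.log (f x)) * Real.exp (-(α * logRatio f g x)) := by rw [Real.exp_log hf]
  rw [h, geomMean, logRatio, Real.log_div hf.ne' hg.ne', Real.rpow_def_of_pos hf,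
    Real.rpow_def_of_pos hg, ← Real.exp_add, ← Real.exp_add]
  ring_nf

theorem geomMean_pos_iff (hf : ∀ x, 0 ≤ f x) (hg : ∀ x, 0 ≤ g x) {α : ℝ}
    (hα : α ∈ Set.Ioo (0 : ℝ) 1) (x : 𝒳) : 0 < geomMean f g α x ↔ 0 < f x ∧ 0 < g x := by
  refine ⟨fun h => ?_, fun h => mul_pos (Real.rpow_pos_of_pos h.1 _) (Real.rpow_pos_of_pos h.2 _)⟩
  constructor
  · refine (hf x).lt_of_ne' fun h0 => h.ne' ?_
    rw [geomMean, h0, Real.zero_rpow (by linarith [hα.2]), zero_mul]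
  · refine (hg x).lt_of_ne' fun h0 => h.ne' ?_
    rw [geomMean, h0, Real.zero_rpow hα.1.ne', mul_zero]

/-- This also holds at the endpoints and where both functions vanish: `1 - α` and `α` are never both
zero, so the default `0 ^ 0 = 1` does no harm. -/
theorem geomMean_self {x : 𝒳} (hfg : f x = g x) (hf : 0 ≤ f x) (α : ℝ) :
    geomMean f g α x = f x := by
  rw [geomMean, ← hfg]
  rcases hf.eq_or_lt with h | h
  · rw [← h]
    by_cases h0 : α = 0
    · simp [h0]
    · simp [Real.zero_rpow h0]
  · rw [← Real.rpow_add h]; simp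

theorem integrable_geomMean (hf : IsDensity ν f) (hg : IsDensity ν g) {α : ℝ}
    (hα : α ∈ Set.Icc (0 : ℝ) 1) : Integrable (geomMean f g α) ν :=
  (hf.integrable.add hg.integrable).mono'
    (measurable_geomMean hf.measurable hg.measurable α).aestronglyMeasurable
    (.of_forall fun x => by
      rw [Real.norm_eq_abs, abs_of_nonneg (geomMean_nonneg hf.nonneg hg.nonneg α x)]
      exact geomMean_le hf.nonneg hg.nonneg hα x)

theorem chernoffMeasure_eq (ν : Measure 𝒳) (f g : 𝒳 → ℝ) (α : ℝ) : chernoffMeasure ν f g α =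
    densityMeasure ν fun x => geomMean f g α x * Real.exp (chernoffDiv ν f g α) := rfl

theorem isDensity_chernoff (hf : IsDensity ν f) (hg : IsDensity ν g) {α : ℝ}
    (hpos : 0 < ∫ x, geomMean f g α x ∂ν) :
    IsDensity ν fun x => f x ^ (1 - α) * g x ^ α * Real.exp (chernoffDiv ν f g α) where
  measurable := (measurable_geomMean hf.measurable hg.measurable α).mul_const _
  nonneg x := mul_nonneg (geomMean_nonneg hf.nonneg hg.nonneg α x) (Real.exp_pos _).le
  integral_eq_one := by
    rw [integral_mul_const, chernoffDiv, Real.exp_neg]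
    change 0 < ∫ x, f x ^ (1 - α) * g x ^ α ∂ν at hpos
    rw [Real.exp_log hpos, mul_inv_cancel₀ hpos.ne']

theorem ae_chernoffMeasure_pos (hf : IsDensity ν f) (hg : IsDensity ν g) {α : ℝ}
    (hα : α ∈ Set.Ioo (0 : ℝ) 1) :
    ∀ᵐ x ∂(chernoffMeasure ν f g α), 0 < f x ∧ 0 < g x := by
  rw [chernoffMeasure_eq, ae_densityMeasure_iff
    ((measurable_geomMean hf.measurable hg.measurable α).mul_const _)]
  refine .of_forall fun x hx => (geomMean_pos_iff hf.nonneg hg.nonneg hα x).1 ?_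
  exact pos_of_mul_pos_left hx (Real.exp_pos _).le

theorem measurable_logRatio (hf : Measurable f) (hg : Measurable g) : Measurable (logRatio f g) :=
  Real.measurable_log.comp (hf.div hg)

theorem measurable_centeredLogRatio (hf : Measurable f) (hg : Measurable g) (α : ℝ) :
    Measurable (centeredLogRatio ν f g α) :=
  (measurable_logRatio hf hg).sub_const _

/-- The measure with density `f` on the set where `g` is positive. -/
noncomputable def overlapMeasure (ν : Measure 𝒳) (f g : 𝒳 → ℝ) : Measure 𝒳 :=
  densityMeasure ν ({x | 0 < g x}.indicator f)

theorem measurable_indicator_pos (hf : Measurable f) (hg : Measurable g) :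
    Measurable ({x | 0 < g x}.indicator f) :=
  hf.indicator (measurableSet_lt measurable_const hg)

theorem indicator_pos_nonneg (hf : ∀ x, 0 ≤ f x) (x : 𝒳) : 0 ≤ {x | 0 < g x}.indicator f x :=
  Set.indicator_nonneg (fun x _ => hf x) x

/-- The indicator is essential: where `g` vanishes, `logRatio` has the default value 0, and without
the indicator the left side would be `f` instead of 0. -/
theorem indicator_mul_exp_eq_geomMean (hf : ∀ x, 0 ≤ f x) (hg : ∀ x, 0 ≤ g x) {α : ℝ}
    (hα : α ∈ Set.Ioo (0 : ℝ) 1) (x : 𝒳) :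
    {x | 0 < g x}.indicator f x * Real.exp (α * -logRatio f g x) = geomMean f g α x := by
  by_cases h : 0 < f x ∧ 0 < g x
  · rw [Set.indicator_of_mem (show x ∈ {x | 0 < g x} from h.2), geomMean_of_pos h.1 h.2, mul_neg]
  · have h0 : geomMean f g α x = 0 :=
      le_antisymm (not_lt.1 (mt (geomMean_pos_iff hf hg hα x).1 h)) (geomMean_nonneg hf hg α x)
    rw [h0]
    by_cases hgx : 0 < g x
    · have : f x = 0 := le_antisymm (not_lt.1 fun hfx => h ⟨hfx, hgx⟩) (hf x)
      rw [Set.indicator_of_mem (show x ∈ {x | 0 < g x} from hgx), this, zero_mul]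
    · rw [Set.indicator_of_notMem (show x ∉ {x | 0 < g x} from hgx), zero_mul]

theorem mgf_overlapMeasure (hf : IsDensity ν f) (hg : IsDensity ν g) {α : ℝ}
    (hα : α ∈ Set.Ioo (0 : ℝ) 1) :
    mgf (fun x => -logRatio f g x) (overlapMeasure ν f g) α = ∫ x, geomMean f g α x ∂ν := by
  rw [mgf, overlapMeasure, integral_densityMeasure
    (measurable_indicator_pos hf.measurable hg.measurable) (indicator_pos_nonneg hf.nonneg)]
  exact integral_congr_ae (.of_forall (indicator_mul_exp_eq_geomMean hf.nonneg hg.nonneg hα))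

theorem chernoffDiv_eq_neg_cgf (hf : IsDensity ν f) (hg : IsDensity ν g) {α : ℝ}
    (hα : α ∈ Set.Ioo (0 : ℝ) 1) :
    chernoffDiv ν f g α = -cgf (fun x => -logRatio f g x) (overlapMeasure ν f g) α := by
  rw [cgf, mgf_overlapMeasure hf hg hα]; rfl

/-- The geometric mean is at most `f + g`, so the moment generating function is finite on all of
`(0, 1)`. This gives moments of every order under the tilt. -/
theorem mem_interior_integrableExpSet (hf : IsDensity ν f) (hg : IsDensity ν g) {α : ℝ}
    (hα : α ∈ Set.Ioo (0 : ℝ) 1) :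
    α ∈ interior (integrableExpSet (fun x => -logRatio f g x) (overlapMeasure ν f g)) := by
  refine (interior_maximal (t := Set.Ioo (0 : ℝ) 1) (fun β hβ => ?_) isOpen_Ioo) hα
  change Integrable _ _
  rw [overlapMeasure, integrable_densityMeasure_iff
    (measurable_indicator_pos hf.measurable hg.measurable) (indicator_pos_nonneg hf.nonneg)]
  exact (integrable_geomMean hf hg (Set.Ioo_subset_Icc_self hβ)).congr
    (.of_forall fun x => (indicator_mul_exp_eq_geomMean hf.nonneg hg.nonneg hβ x).symm)

/-- This identification turns the mean and the variance of the log-ratio into derivatives of a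
cumulant generating function. -/
theorem chernoffMeasure_eq_tilted (hf : IsDensity ν f) (hg : IsDensity ν g) {α : ℝ}
    (hα : α ∈ Set.Ioo (0 : ℝ) 1) (hpos : 0 < ∫ x, geomMean f g α x ∂ν) :
    chernoffMeasure ν f g α =
      (overlapMeasure ν f g).tilted fun x => α * -logRatio f g x := by
  have hmgf : ∫ x, Real.exp (α * -logRatio f g x) ∂(overlapMeasure ν f g)
      = ∫ x, geomMean f g α x ∂ν := mgf_overlapMeasure hf hg hα
  have hL := measurable_logRatio hf.measurable hg.measurable
  rw [Measure.tilted, hmgf, overlapMeasure, densityMeasure, ← withDensity_mul, chernoffMeasure,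
    densityMeasure]
  · congr 1
    ext x
    rw [Pi.mul_apply, ← ENNReal.ofReal_mul (indicator_pos_nonneg hf.nonneg x), ← mul_div_assoc,
      indicator_mul_exp_eq_geomMean hf.nonneg hg.nonneg hα, chernoffDiv, Real.exp_neg,
      div_eq_mul_inv]
    change 0 < ∫ x, f x ^ (1 - α) * g x ^ α ∂ν at hpos
    rw [Real.exp_log hpos]
    rfl
  · exact (measurable_indicator_pos hf.measurable hg.measurable).ennreal_ofReal
  · fun_prop

theorem memLp_logRatio (hf : IsDensity ν f) (hg : IsDensity ν g) {α : ℝ}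
    (hα : α ∈ Set.Ioo (0 : ℝ) 1) (hpos : 0 < ∫ x, geomMean f g α x ∂ν) (p : NNReal) :
    MemLp (logRatio f g) p (chernoffMeasure ν f g α) := by
  have := (memLp_tilted_mul (mem_interior_integrableExpSet hf hg hα) p).neg
  rw [chernoffMeasure_eq_tilted hf hg hα hpos]
  simpa [Pi.neg_def] using this

theorem integral_logRatio (hf : IsDensity ν f) (hg : IsDensity ν g) {α : ℝ}
    (hα : α ∈ Set.Ioo (0 : ℝ) 1) (hpos : 0 < ∫ x, geomMean f g α x ∂ν) :
    ∫ x, logRatio f g x ∂(chernoffMeasure ν f g α) = deriv (chernoffDiv ν f g) α := by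
  have h1 := integral_tilted_mul_self (mem_interior_integrableExpSet hf hg hα)
  have h2 : chernoffDiv ν f g =ᶠ[nhds α]
      -cgf (fun x => -logRatio f g x) (overlapMeasure ν f g) :=
    Filter.eventually_of_mem (Ioo_mem_nhds hα.1 hα.2) fun β hβ => chernoffDiv_eq_neg_cgf hf hg hβ
  rw [h2.deriv_eq, deriv.neg, ← h1, chernoffMeasure_eq_tilted hf hg hα hpos, ← integral_neg]
  simp

theorem varZ_eq_variance (hf : IsDensity ν f) (hg : IsDensity ν g) {α : ℝ}
    (hα : α ∈ Set.Ioo (0 : ℝ) 1) (hpos : 0 < ∫ x, geomMean f g α x ∂ν) :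
    varZ ν f g α = iteratedDeriv 2 (fun β => Real.log (∫ x, geomMean f g β x ∂ν)) α := by
  have := (isDensity_chernoff hf hg hpos).isProbabilityMeasure
  change IsProbabilityMeasure (chernoffMeasure ν f g α) at this
  have h1 := variance_tilted_mul (mem_interior_integrableExpSet hf hg hα)
  have h2 : cgf (fun x => -logRatio f g x) (overlapMeasure ν f g) =ᶠ[nhds α]
      fun β => Real.log (∫ x, geomMean f g β x ∂ν) :=
    Filter.eventually_of_mem (Ioo_mem_nhds hα.1 hα.2) fun β hβ => by
      dsimp only
      rw [cgf, mgf_overlapMeasure hf hg hβ]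
  rw [← h2.iteratedDeriv_eq, ← h1, varZ, ← chernoffMeasure_eq_tilted hf hg hα hpos]
  have h3 := variance_sub_const (μ := chernoffMeasure ν f g α)
    (measurable_logRatio hf.measurable hg.measurable).aestronglyMeasurable
    (∫ x, logRatio f g x ∂(chernoffMeasure ν f g α))
  have h4 := variance_fun_neg (X := logRatio f g) (μ := chernoffMeasure ν f g α)
  rw [h4]
  exact h3

/-- The affinity is the expectation of `gFun` times the exponential of the divergence. -/
theorem affinity_eq (hf : IsDensity ν f) (hg : IsDensity ν g) {α : ℝ}
    (hα : α ∈ Set.Ioo (0 : ℝ) 1) :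
    affinity ν f g = expectG ν f g α * Real.exp (-chernoffDiv ν f g α) := by
  rw [affinity, expectG, chernoffMeasure_eq, integral_densityMeasure
    ((measurable_geomMean hf.measurable hg.measurable α).mul_const _)
    fun x => mul_nonneg (geomMean_nonneg hf.nonneg hg.nonneg α x) (Real.exp_pos _).le,
    ← integral_mul_const]
  congr 1
  ext x
  change _ = geomMean f g α x * _ * _ * _
  by_cases h : 0 < f x ∧ 0 < g x
  · have h1 : geomMean f g α x * gFun α (logRatio f g x) = min (f x) (g x) := by
      have h3 : min (f x) (g x) = Real.exp (min (Real.log (f x)) (Real.log (g x))) := by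
        rw [Real.exp_monotone.map_min, Real.exp_log h.1, Real.exp_log h.2]
      rw [geomMean_of_pos h.1 h.2, h3]
      nth_rewrite 1 [← Real.exp_log h.1]
      rw [gFun, ← Real.exp_add, ← Real.exp_add, ← min_add_add_left, logRatio,
        Real.log_div h.1.ne' h.2.ne']
      ring_nf
    rw [← h1, mul_assoc, mul_assoc, mul_comm (gFun _ _), ← mul_assoc (Real.exp _),
      ← Real.exp_add]
    simp
  · have h0 : geomMean f g α x = 0 :=
      le_antisymm (not_lt.1 (mt (geomMean_pos_iff hf.nonneg hg.nonneg hα x).1 h))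
        (geomMean_nonneg hf.nonneg hg.nonneg α x)
    rw [h0, zero_mul, zero_mul, zero_mul]
    rw [not_and_or, not_lt, not_lt] at h
    rcases h with h | h
    · rw [min_eq_left (h.trans (hg.nonneg x))]; exact le_antisymm h (hf.nonneg x)
    · rw [min_eq_right (h.trans (hf.nonneg x))]; exact le_antisymm h (hg.nonneg x)

end Density

/-! ### Existence and uniqueness of the Chernoff point, and its first-order condition. -/

section Maximizer

variable {𝒳 : Type u} [MeasurableSpace 𝒳] {ν : Measure 𝒳} {f g : 𝒳 → ℝ}

theorem integral_geomMean_pos (hf : IsDensity ν f) (hg : IsDensity ν g)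
    (hfg : ∀ᵐ x ∂ν, 0 < f x ↔ 0 < g x) {α : ℝ} (hα : α ∈ Set.Ioo (0 : ℝ) 1) :
    0 < ∫ x, geomMean f g α x ∂ν := by
  refine (integral_nonneg (geomMean_nonneg hf.nonneg hg.nonneg α)).lt_of_ne' fun h0 => ?_
  rw [integral_eq_zero_iff_of_nonneg (geomMean_nonneg hf.nonneg hg.nonneg α)
    (integrable_geomMean hf hg (Set.Ioo_subset_Icc_self hα))] at h0
  have h1 : f =ᵐ[ν] 0 := by
    filter_upwards [h0, hfg] with x hx hx'
    by_contra hne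
    have hpos : 0 < f x := (hf.nonneg x).lt_of_ne' hne
    exact ((geomMean_pos_iff hf.nonneg hg.nonneg hα x).2 ⟨hpos, hx'.1 hpos⟩).ne' hx
  have := hf.integral_eq_one
  rw [integral_congr_ae h1] at this
  simp at this

/-- Domination by `f + g`. The common support is needed at the endpoints, where the integrand would
jump at points at which exactly one density vanishes. -/
theorem continuousOn_integral_geomMean (hf : IsDensity ν f) (hg : IsDensity ν g)
    (hfg : ∀ᵐ x ∂ν, 0 < f x ↔ 0 < g x) :
    ContinuousOn (fun α => ∫ x, geomMean f g α x ∂ν) (Set.Icc 0 1) := by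
  refine continuousOn_of_dominated (bound := fun x => f x + g x)
    (fun α _ => (measurable_geomMean hf.measurable hg.measurable α).aestronglyMeasurable)
    (fun α hα => .of_forall fun x => ?_) (hf.integrable.add hg.integrable) ?_
  · rw [Real.norm_eq_abs, abs_of_nonneg (geomMean_nonneg hf.nonneg hg.nonneg α x)]
    exact geomMean_le hf.nonneg hg.nonneg hα x
  · filter_upwards [hfg] with x hx
    by_cases h : 0 < f x
    · simp_rw [geomMean_of_pos h (hx.1 h)]
      fun_prop
    · have h1 : f x = 0 := le_antisymm (not_lt.1 h) (hf.nonneg x)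
      have h2 : g x = 0 := le_antisymm (not_lt.1 (mt hx.2 h)) (hg.nonneg x)
      simp_rw [geomMean_self (h1.trans h2.symm) (hf.nonneg x)]
      exact continuousOn_const

/-- Pointwise, `α ↦ f exp(-α L)` is strictly convex where `f ≠ g` and constant where `f = g`. The
convexity defect `d` is thus nonnegative, and its integral vanishes only if the densities agree
almost everywhere. -/
theorem strictConvexOn_integral_geomMean (hf : IsDensity ν f) (hg : IsDensity ν g)
    (hfg : ∀ᵐ x ∂ν, 0 < f x ↔ 0 < g x) (hne : ¬ f =ᵐ[ν] g) :
    StrictConvexOn ℝ (Set.Icc 0 1) fun α => ∫ x, geomMean f g α x ∂ν := by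
  refine ⟨convex_Icc 0 1, fun a ha b hb hab s t hs ht hst => ?_⟩
  have hm := (convex_Icc (0 : ℝ) 1) ha hb hs.le ht.le hst
  have hia := integrable_geomMean hf hg ha
  have hib := integrable_geomMean hf hg hb
  have him := integrable_geomMean hf hg hm
  simp only [smul_eq_mul] at him ⊢
  set d : 𝒳 → ℝ := fun x => s * geomMean f g a x + t * geomMean f g b x
    - geomMean f g (s * a + t * b) x with hd
  have hdi : Integrable d ν := ((hia.const_mul s).add (hib.const_mul t)).sub him
  have hdpos : ∀ x, 0 < f x → 0 < g x → f x ≠ g x → 0 < d x := by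
    intro x hfx hgx hx
    have hL : logRatio f g x ≠ 0 := by
      rw [logRatio, Real.log_div hfx.ne' hgx.ne', sub_ne_zero]
      exact fun h => hx (Real.log_injOn_pos hfx hgx h)
    have h1 := strictConvexOn_exp.2 (Set.mem_univ (-(a * logRatio f g x)))
      (Set.mem_univ (-(b * logRatio f g x)))
      (fun h => hab (mul_right_cancel₀ hL (neg_injective h))) hs ht hst
    simp only [smul_eq_mul] at h1
    rw [hd]
    dsimp only
    rw [geomMean_of_pos hfx hgx, geomMean_of_pos hfx hgx, geomMean_of_pos hfx hgx]
    rw [show s * -(a * logRatio f g x) + t * -(b * logRatio f g x)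
      = -((s * a + t * b) * logRatio f g x) by ring] at h1
    have := mul_lt_mul_of_pos_left h1 hfx
    linarith
  have hdeq : ∀ x, f x = g x → d x = 0 := by
    intro x hx
    rw [hd]
    dsimp only
    rw [geomMean_self hx (hf.nonneg x), geomMean_self hx (hf.nonneg x),
      geomMean_self hx (hf.nonneg x), ← add_mul, hst, one_mul, sub_self]
  have hd0 : 0 ≤ᵐ[ν] d := by
    filter_upwards [hfg] with x hx
    by_cases h : f x = g x
    · exact (hdeq x h).ge
    · rcases (hf.nonneg x).eq_or_lt with h1 | h1
      · exact absurd (le_antisymm (by rw [← h1]; exact hg.nonneg x)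
          (by rw [← h1] at hx ⊢; exact not_lt.1 (mt hx.2 (lt_irrefl _)))) h
      · exact (hdpos x h1 (hx.1 h1) h).le
  have hpos : 0 < ∫ x, d x ∂ν := by
    refine (integral_nonneg_of_ae hd0).lt_of_ne' fun h0 => hne ?_
    rw [integral_eq_zero_iff_of_nonneg_ae hd0 hdi] at h0
    filter_upwards [h0, hfg] with x h1 h2
    by_contra hx
    rcases (hf.nonneg x).eq_or_lt with h3 | h3
    · exact hx (le_antisymm (by rw [← h3]; exact hg.nonneg x)
        (by rw [← h3] at h2 ⊢; exact not_lt.1 (mt h2.2 (lt_irrefl _))))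
    · exact (hdpos x h3 (h2.1 h3) hx).ne' h1
  have hval : ∫ x, d x ∂ν = s * (∫ x, geomMean f g a x ∂ν) + t * (∫ x, geomMean f g b x ∂ν)
      - ∫ x, geomMean f g (s * a + t * b) x ∂ν := by
    have h1 : Integrable (fun x => s * geomMean f g a x + t * geomMean f g b x) ν :=
      (hia.const_mul s).add (hib.const_mul t)
    rw [hd, integral_sub h1 him, integral_add (hia.const_mul s) (hib.const_mul t),
      integral_const_mul, integral_const_mul]
  linarith

theorem isChernoffPoint_iff (hf : IsDensity ν f) (hg : IsDensity ν g)
    (hfg : ∀ᵐ x ∂ν, 0 < f x ↔ 0 < g x) {α : ℝ} :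
    IsChernoffPoint ν f g α ↔ α ∈ Set.Ioo (0 : ℝ) 1 ∧
      IsMinOn (fun α => ∫ x, geomMean f g α x ∂ν) (Set.Ioo 0 1) α := by
  refine and_congr_right fun hα => ?_
  rw [isMaxOn_iff, isMinOn_iff]
  refine forall₂_congr fun β hβ => ?_
  change -Real.log (∫ x, geomMean f g β x ∂ν) ≤ -Real.log (∫ x, geomMean f g α x ∂ν) ↔ _
  rw [neg_le_neg_iff, Real.log_le_log_iff (integral_geomMean_pos hf hg hfg hα)
    (integral_geomMean_pos hf hg hfg hβ)]

/-- The integral is 1 at both endpoints and, by strict convexity, below 1 at 1/2, so its minimum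
over `[0, 1]` is attained in the interior. -/
theorem existsUnique_isChernoffPoint (hf : IsDensity ν f) (hg : IsDensity ν g)
    (hfg : ∀ᵐ x ∂ν, 0 < f x ↔ 0 < g x) (hne : ¬ f =ᵐ[ν] g) :
    ∃! α : ℝ, IsChernoffPoint ν f g α := by
  have hconv := strictConvexOn_integral_geomMean hf hg hfg hne
  have h0 : ∫ x, geomMean f g 0 x ∂ν = 1 := by
    simpa [geomMean] using hf.integral_eq_one
  have h1 : ∫ x, geomMean f g 1 x ∂ν = 1 := by
    simpa [geomMean] using hg.integral_eq_one
  obtain ⟨α, hα, hmin⟩ := isCompact_Icc.exists_isMinOn (Set.nonempty_Icc.2 zero_le_one)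
    (continuousOn_integral_geomMean hf hg hfg)
  have hhalf : ∫ x, geomMean f g (1 / 2) x ∂ν < 1 := by
    have := hconv.2 (Set.left_mem_Icc.2 zero_le_one) (Set.right_mem_Icc.2 zero_le_one) zero_ne_one
      (show (0 : ℝ) < 1 / 2 by norm_num) (show (0 : ℝ) < 1 / 2 by norm_num) (by norm_num)
    simp only [smul_eq_mul, h0, h1] at this
    norm_num at this ⊢
    exact this
  have hlt : ∫ x, geomMean f g α x ∂ν < 1 :=
    lt_of_le_of_lt (isMinOn_iff.1 hmin (1 / 2) (by norm_num)) hhalf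
  have hα' : α ∈ Set.Ioo (0 : ℝ) 1 := by
    refine ⟨hα.1.lt_of_ne fun h => ?_, hα.2.lt_of_ne fun h => ?_⟩
    · rw [← h, h0] at hlt; exact lt_irrefl _ hlt
    · rw [h, h1] at hlt; exact lt_irrefl _ hlt
  refine ⟨α, (isChernoffPoint_iff hf hg hfg).2
    ⟨hα', hmin.on_subset Set.Ioo_subset_Icc_self⟩, fun β hβ => ?_⟩
  obtain ⟨hβ1, hβ2⟩ := (isChernoffPoint_iff hf hg hfg).1 hβ
  exact (hconv.subset Set.Ioo_subset_Icc_self (convex_Ioo 0 1)).eq_of_isMinOn hβ2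
    (hmin.on_subset Set.Ioo_subset_Icc_self) hβ1 hα'

theorem IsChernoffPoint.integral_logRatio_eq_zero {α : ℝ} (h : IsChernoffPoint ν f g α)
    (hf : IsDensity ν f) (hg : IsDensity ν g) (hfg : ∀ᵐ x ∂ν, 0 < f x ↔ 0 < g x) :
    ∫ x, logRatio f g x ∂(chernoffMeasure ν f g α) = 0 := by
  rw [integral_logRatio hf hg h.1 (integral_geomMean_pos hf hg hfg h.1)]
  exact (h.2.isLocalMax (Ioo_mem_nhds h.1.1 h.1.2)).deriv_eq_zero

theorem ae_pos_of_densityMeasure_absolutelyContinuous (hf : IsDensity ν f) (hg : IsDensity ν g)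
    (h : densityMeasure ν f ≪ densityMeasure ν g) : ∀ᵐ x ∂ν, 0 < f x → 0 < g x := by
  have h1 : ∀ᵐ x ∂(densityMeasure ν g), 0 < g x :=
    (ae_densityMeasure_iff hg.measurable).2 (.of_forall fun x hx => hx)
  exact (ae_densityMeasure_iff hf.measurable).1 (h.ae_le h1)

theorem ae_eq_of_ae_chernoffMeasure_logRatio_eq_zero {α : ℝ} (hα : α ∈ Set.Ioo (0 : ℝ) 1)
    (hf : IsDensity ν f) (hg : IsDensity ν g) (hfg : ∀ᵐ x ∂ν, 0 < f x ↔ 0 < g x)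
    (h : ∀ᵐ x ∂(chernoffMeasure ν f g α), logRatio f g x = 0) : f =ᵐ[ν] g := by
  rw [chernoffMeasure_eq, ae_densityMeasure_iff
    ((measurable_geomMean hf.measurable hg.measurable α).mul_const _)] at h
  filter_upwards [h, hfg] with x h1 h2
  by_cases hx : 0 < f x
  · have := h1 (mul_pos ((geomMean_pos_iff hf.nonneg hg.nonneg hα x).2 ⟨hx, h2.1 hx⟩)
      (Real.exp_pos _))
    rw [logRatio, Real.log_div hx.ne' (h2.1 hx).ne', sub_eq_zero] at this
    exact Real.log_injOn_pos hx (h2.1 hx) this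
  · rw [le_antisymm (not_lt.1 hx) (hf.nonneg x),
      le_antisymm (not_lt.1 (mt h2.2 hx)) (hg.nonneg x)]

end Maximizer

/-! ### Product densities: independence, and reduction to a centered sum. -/

section Product

variable {n : ℕ} {Ω : Fin n → Type u} [∀ j, MeasurableSpace (Ω j)] {μ : ∀ j, Measure (Ω j)}
  [∀ j, SigmaFinite (μ j)] {φ₀ φ₁ : ∀ j, Ω j → ℝ}

theorem isDensity_prodDensity {φ : ∀ j, Ω j → ℝ} (h : ∀ j, IsDensity (μ j) (φ j)) :
    IsDensity (Measure.pi μ) (prodDensity φ) where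
  measurable := Finset.measurable_prod _ fun j _ => (h j).measurable.comp (measurable_pi_apply j)
  nonneg x := Finset.prod_nonneg fun j _ => (h j).nonneg _
  integral_eq_one := by
    unfold prodDensity
    rw [integral_fintype_prod_eq_prod]
    exact Finset.prod_eq_one fun j _ => (h j).integral_eq_one

theorem densityMeasure_pi {φ : ∀ j, Ω j → ℝ} (h : ∀ j, IsDensity (μ j) (φ j)) :
    densityMeasure (Measure.pi μ) (prodDensity φ) =
      Measure.pi fun j => densityMeasure (μ j) (φ j) := by
  have := fun j => (h j).isProbabilityMeasure
  symm
  refine Measure.pi_eq fun s hs => ?_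
  rw [densityMeasure, withDensity_apply _ (MeasurableSet.univ_pi hs),
    ← ofReal_integral_eq_lintegral_ofReal (isDensity_prodDensity h).integrable.integrableOn
      (.of_forall (isDensity_prodDensity h).nonneg), Measure.restrict_pi_pi]
  unfold prodDensity
  rw [integral_fintype_prod_eq_prod, ENNReal.ofReal_prod_of_nonneg
    fun j _ => integral_nonneg (h j).nonneg]
  refine Finset.prod_congr rfl fun j _ => ?_
  rw [densityMeasure, withDensity_apply _ (hs j),
    ofReal_integral_eq_lintegral_ofReal (h j).integrable.integrableOn (.of_forall (h j).nonneg)]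

theorem geomMean_prodDensity (h0 : ∀ j x, 0 ≤ φ₀ j x) (h1 : ∀ j x, 0 ≤ φ₁ j x) (α : ℝ) :
    geomMean (prodDensity φ₀) (prodDensity φ₁) α =
      prodDensity fun j => geomMean (φ₀ j) (φ₁ j) α := by
  ext x
  simp only [geomMean, prodDensity]
  rw [← Real.finsetProd_rpow _ _ fun j _ => h0 j _, ← Real.finsetProd_rpow _ _ fun j _ => h1 j _,
    Finset.prod_mul_distrib]

theorem integral_geomMean_prodDensity (h0 : ∀ j x, 0 ≤ φ₀ j x) (h1 : ∀ j x, 0 ≤ φ₁ j x) (α : ℝ) :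
    ∫ x, geomMean (prodDensity φ₀) (prodDensity φ₁) α x ∂(Measure.pi μ) =
      ∏ j, ∫ x, geomMean (φ₀ j) (φ₁ j) α x ∂(μ j) := by
  rw [geomMean_prodDensity h0 h1]
  unfold prodDensity
  rw [integral_fintype_prod_eq_prod]

namespace IsTestingPair

theorem isDensity_zero (h : IsTestingPair μ φ₀ φ₁) : IsDensity (Measure.pi μ) (prodDensity φ₀) :=
  isDensity_prodDensity h.density_zero

theorem isDensity_one (h : IsTestingPair μ φ₀ φ₁) : IsDensity (Measure.pi μ) (prodDensity φ₁) :=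
  isDensity_prodDensity h.density_one

/-- Finiteness of each divergence forces absolute continuity, so the two products share their
support. -/
theorem ae_pos_iff (h : IsTestingPair μ φ₀ φ₁) :
    ∀ᵐ x ∂(Measure.pi μ), 0 < prodDensity φ₀ x ↔ 0 < prodDensity φ₁ x := by
  filter_upwards [ae_pos_of_densityMeasure_absolutelyContinuous h.isDensity_zero h.isDensity_one
    (InformationTheory.klDiv_ne_top_iff.1 h.kl_zero_one_lt_top.ne).1,
    ae_pos_of_densityMeasure_absolutelyContinuous h.isDensity_one h.isDensity_zero
    (InformationTheory.klDiv_ne_top_iff.1 h.kl_one_zero_lt_top.ne).1] with x h1 h2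
  exact ⟨h1, h2⟩

theorem not_ae_eq (h : IsTestingPair μ φ₀ φ₁) :
    ¬ prodDensity φ₀ =ᵐ[Measure.pi μ] prodDensity φ₁ := by
  intro heq
  have h1 : densityMeasure (Measure.pi μ) (prodDensity φ₀)
      = densityMeasure (Measure.pi μ) (prodDensity φ₁) :=
    withDensity_congr_ae (heq.mono fun x hx => by simp only [hx])
  have h2 := h.kl_zero_one_pos
  have := h.isDensity_one.isProbabilityMeasure
  rw [h1, InformationTheory.klDiv_self] at h2
  exact lt_irrefl _ h2

/-- The common support is known for the products only; positivity of each factor is read off from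
positivity of the product of integrals. -/
theorem integral_geomMean_pos (h : IsTestingPair μ φ₀ φ₁) {α : ℝ} (hα : α ∈ Set.Ioo (0 : ℝ) 1)
    (j : Fin n) : 0 < ∫ x, geomMean (φ₀ j) (φ₁ j) α x ∂(μ j) := by
  have h1 := _root_.integral_geomMean_pos h.isDensity_zero h.isDensity_one h.ae_pos_iff hα
  rw [integral_geomMean_prodDensity (fun j => (h.density_zero j).nonneg)
    fun j => (h.density_one j).nonneg] at h1
  exact (integral_nonneg (geomMean_nonneg (h.density_zero j).nonneg
    (h.density_one j).nonneg α)).lt_of_ne' (Finset.prod_ne_zero_iff.1 h1.ne' j (Finset.mem_univ j))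

theorem chernoffDiv_eq_sum (h : IsTestingPair μ φ₀ φ₁) {α : ℝ} (hα : α ∈ Set.Ioo (0 : ℝ) 1) :
    chernoffDiv (Measure.pi μ) (prodDensity φ₀) (prodDensity φ₁) α =
      ∑ j, chernoffDiv (μ j) (φ₀ j) (φ₁ j) α := by
  change -Real.log (∫ x, geomMean (prodDensity φ₀) (prodDensity φ₁) α x ∂(Measure.pi μ)) =
    ∑ j, -Real.log (∫ x, geomMean (φ₀ j) (φ₁ j) α x ∂(μ j))
  rw [integral_geomMean_prodDensity (fun j => (h.density_zero j).nonneg)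
    (fun j => (h.density_one j).nonneg), Real.log_prod fun j _ => (h.integral_geomMean_pos hα j).ne',
    Finset.sum_neg_distrib]

theorem chernoffMeasure_pi (h : IsTestingPair μ φ₀ φ₁) {α : ℝ} (hα : α ∈ Set.Ioo (0 : ℝ) 1) :
    chernoffMeasure (Measure.pi μ) (prodDensity φ₀) (prodDensity φ₁) α =
      Measure.pi fun j => chernoffMeasure (μ j) (φ₀ j) (φ₁ j) α := by
  have h1 := densityMeasure_pi fun j => isDensity_chernoff (h.density_zero j) (h.density_one j)
    (h.integral_geomMean_pos hα j)
  refine Eq.trans ?_ h1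
  rw [chernoffMeasure_eq, geomMean_prodDensity (fun j => (h.density_zero j).nonneg)
    (fun j => (h.density_one j).nonneg), h.chernoffDiv_eq_sum hα]
  congr 1
  ext x
  simp only [prodDensity]
  rw [Finset.prod_mul_distrib, Real.exp_sum]
  rfl

theorem isProbabilityMeasure_chernoffMeasure (h : IsTestingPair μ φ₀ φ₁) {α : ℝ}
    (hα : α ∈ Set.Ioo (0 : ℝ) 1) (j : Fin n) :
    IsProbabilityMeasure (chernoffMeasure (μ j) (φ₀ j) (φ₁ j) α) :=
  (isDensity_chernoff (h.density_zero j) (h.density_one j)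
    (h.integral_geomMean_pos hα j)).isProbabilityMeasure

theorem memLp_centeredLogRatio (h : IsTestingPair μ φ₀ φ₁) {α : ℝ} (hα : α ∈ Set.Ioo (0 : ℝ) 1)
    (j : Fin n) : MemLp (centeredLogRatio (μ j) (φ₀ j) (φ₁ j) α) 3
      (chernoffMeasure (μ j) (φ₀ j) (φ₁ j) α) := by
  have := h.isProbabilityMeasure_chernoffMeasure hα j
  exact (memLp_logRatio (h.density_zero j) (h.density_one j) hα (h.integral_geomMean_pos hα j) 3).sub
    (memLp_const _)

theorem integral_centeredLogRatio (h : IsTestingPair μ φ₀ φ₁) {α : ℝ}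
    (hα : α ∈ Set.Ioo (0 : ℝ) 1) (j : Fin n) :
    ∫ x, centeredLogRatio (μ j) (φ₀ j) (φ₁ j) α x ∂(chernoffMeasure (μ j) (φ₀ j) (φ₁ j) α) = 0 := by
  have := h.isProbabilityMeasure_chernoffMeasure hα j
  have h1 := (memLp_logRatio (h.density_zero j) (h.density_one j) hα
    (h.integral_geomMean_pos hα j) 1).integrable (by norm_num)
  unfold centeredLogRatio
  rw [integral_sub h1 (integrable_const _)]
  simp

theorem isCenteredFamily (h : IsTestingPair μ φ₀ φ₁) {α : ℝ} (hα : α ∈ Set.Ioo (0 : ℝ) 1) :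
    IsCenteredFamily (fun j (x : ∀ j, Ω j) => centeredLogRatio (μ j) (φ₀ j) (φ₁ j) α (x j))
      (chernoffMeasure (Measure.pi μ) (prodDensity φ₀) (prodDensity φ₁) α) := by
  have := h.isProbabilityMeasure_chernoffMeasure hα
  have hm := fun j => measurable_centeredLogRatio (ν := μ j) (h.density_zero j).measurable
    (h.density_one j).measurable α
  rw [h.chernoffMeasure_pi hα]
  refine ⟨fun j => (hm j).comp (measurable_pi_apply j), iIndepFun_pi fun j => (hm j).aemeasurable,
    fun j => (h.memLp_centeredLogRatio hα j).comp_measurePreserving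
      (measurePreserving_eval _ j), fun j => ?_⟩
  rw [integral_comp_eval (μ := fun j => chernoffMeasure (μ j) (φ₀ j) (φ₁ j) α)
    (hm j).aestronglyMeasurable]
  exact h.integral_centeredLogRatio hα j

theorem integral_comp_eval_chernoffMeasure (h : IsTestingPair μ φ₀ φ₁) {α : ℝ}
    (hα : α ∈ Set.Ioo (0 : ℝ) 1) (j : Fin n) {F : Ω j → ℝ} (hF : Measurable F) :
    ∫ x, F (x j) ∂(chernoffMeasure (Measure.pi μ) (prodDensity φ₀) (prodDensity φ₁) α) =
      ∫ x, F x ∂(chernoffMeasure (μ j) (φ₀ j) (φ₁ j) α) := by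
  have := h.isProbabilityMeasure_chernoffMeasure hα
  rw [h.chernoffMeasure_pi hα]
  exact integral_comp_eval (μ := fun j => chernoffMeasure (μ j) (φ₀ j) (φ₁ j) α)
    hF.aestronglyMeasurable

theorem integral_sq_eq_varZ (h : IsTestingPair μ φ₀ φ₁) {α : ℝ} (hα : α ∈ Set.Ioo (0 : ℝ) 1)
    (j : Fin n) : ∫ x, centeredLogRatio (μ j) (φ₀ j) (φ₁ j) α (x j) ^ 2
      ∂(chernoffMeasure (Measure.pi μ) (prodDensity φ₀) (prodDensity φ₁) α) =
      varZ (μ j) (φ₀ j) (φ₁ j) α := by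
  have hm := measurable_centeredLogRatio (ν := μ j) (h.density_zero j).measurable
    (h.density_one j).measurable α
  rw [h.integral_comp_eval_chernoffMeasure hα j
    (F := fun y => centeredLogRatio (μ j) (φ₀ j) (φ₁ j) α y ^ 2) (hm.pow_const 2), varZ,
    variance_of_integral_eq_zero hm.aemeasurable (h.integral_centeredLogRatio hα j)]

theorem integral_abs_cube_eq_absThirdMomentZ (h : IsTestingPair μ φ₀ φ₁) {α : ℝ}
    (hα : α ∈ Set.Ioo (0 : ℝ) 1) (j : Fin n) :
    ∫ x, |centeredLogRatio (μ j) (φ₀ j) (φ₁ j) α (x j)| ^ 3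
      ∂(chernoffMeasure (Measure.pi μ) (prodDensity φ₀) (prodDensity φ₁) α) =
      absThirdMomentZ (μ j) (φ₀ j) (φ₁ j) α := by
  have hm := measurable_centeredLogRatio (ν := μ j) (h.density_zero j).measurable
    (h.density_one j).measurable α
  exact h.integral_comp_eval_chernoffMeasure hα j
    (F := fun y => |centeredLogRatio (μ j) (φ₀ j) (φ₁ j) α y| ^ 3) (hm.norm.pow_const 3)

/-- At the Chernoff point the log-likelihood ratio is the sum of its centered coordinates. -/
theorem ae_logRatio_eq_sum (h : IsTestingPair μ φ₀ φ₁) {α : ℝ}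
    (hα : IsChernoffPoint (Measure.pi μ) (prodDensity φ₀) (prodDensity φ₁) α) :
    ∀ᵐ x ∂(chernoffMeasure (Measure.pi μ) (prodDensity φ₀) (prodDensity φ₁) α),
      logRatio (prodDensity φ₀) (prodDensity φ₁) x =
        ∑ j, centeredLogRatio (μ j) (φ₀ j) (φ₁ j) α (x j) := by
  have hprob := h.isProbabilityMeasure_chernoffMeasure hα.1
  have hsum : ∀ᵐ x ∂(chernoffMeasure (Measure.pi μ) (prodDensity φ₀) (prodDensity φ₁) α),
      logRatio (prodDensity φ₀) (prodDensity φ₁) x =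
        (∑ j, centeredLogRatio (μ j) (φ₀ j) (φ₁ j) α (x j)) +
        ∑ j, ∫ y, logRatio (φ₀ j) (φ₁ j) y ∂(chernoffMeasure (μ j) (φ₀ j) (φ₁ j) α) := by
    filter_upwards [ae_chernoffMeasure_pos h.isDensity_zero h.isDensity_one hα.1] with x hx
    rw [← Finset.sum_add_distrib]
    simp only [centeredLogRatio, sub_add_cancel, logRatio]
    rw [Real.log_div hx.1.ne' hx.2.ne', prodDensity, prodDensity,
      Real.log_prod (Finset.prod_ne_zero_iff.1 hx.1.ne'),
      Real.log_prod (Finset.prod_ne_zero_iff.1 hx.2.ne'), ← Finset.sum_sub_distrib]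
    refine Finset.sum_congr rfl fun j hj => ?_
    rw [Real.log_div (Finset.prod_ne_zero_iff.1 hx.1.ne' j hj)
      (Finset.prod_ne_zero_iff.1 hx.2.ne' j hj)]
  have hfam := h.isCenteredFamily hα.1
  have hQ : IsProbabilityMeasure
      (chernoffMeasure (Measure.pi μ) (prodDensity φ₀) (prodDensity φ₁) α) := by
    rw [h.chernoffMeasure_pi hα.1]; infer_instance
  -- The coordinate means need not vanish one by one, but their sum is the mean of the full
  -- log-ratio, which is zero at the maximizer.
  have h0 := hα.integral_logRatio_eq_zero h.isDensity_zero h.isDensity_one h.ae_pos_iff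
  rw [integral_congr_ae hsum, integral_add (hfam.integrable_sum Finset.univ) (integrable_const _),
    integral_finsetSum _ fun j _ => hfam.integrable j] at h0
  simp only [hfam.mean, Finset.sum_const_zero, zero_add, integral_const, probReal_univ,
    one_smul] at h0
  filter_upwards [hsum] with x hx
  rw [hx, h0, add_zero]

/-- If all variances vanished, the log-ratio would be zero almost surely and the two products would
coincide, against the positivity of the divergence. -/
theorem sum_varZ_pos (h : IsTestingPair μ φ₀ φ₁) {α : ℝ}
    (hα : IsChernoffPoint (Measure.pi μ) (prodDensity φ₀) (prodDensity φ₁) α) :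
    0 < ∑ j, varZ (μ j) (φ₀ j) (φ₁ j) α := by
  have hnn : ∀ j, 0 ≤ varZ (μ j) (φ₀ j) (φ₁ j) α := fun j => variance_nonneg _ _
  refine (Finset.sum_nonneg fun j _ => hnn j).lt_of_ne' fun h0 => h.not_ae_eq ?_
  refine ae_eq_of_ae_chernoffMeasure_logRatio_eq_zero hα.1 h.isDensity_zero h.isDensity_one
    h.ae_pos_iff ?_
  have hQ : IsProbabilityMeasure
      (chernoffMeasure (Measure.pi μ) (prodDensity φ₀) (prodDensity φ₁) α) := by
    have := h.isProbabilityMeasure_chernoffMeasure hα.1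
    rw [h.chernoffMeasure_pi hα.1]; infer_instance
  have hfam := h.isCenteredFamily hα.1
  have hz : ∀ j, ∀ᵐ x ∂(chernoffMeasure (Measure.pi μ) (prodDensity φ₀) (prodDensity φ₁) α),
      centeredLogRatio (μ j) (φ₀ j) (φ₁ j) α (x j) = 0 := fun j => by
    have h1 := h.integral_sq_eq_varZ hα.1 j
    rw [(Finset.sum_eq_zero_iff_of_nonneg fun j _ => hnn j).1 h0 j (Finset.mem_univ j),
      integral_eq_zero_iff_of_nonneg (fun x => sq_nonneg _) (hfam.integrable_sq j)] at h1
    filter_upwards [h1] with x hx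
    simpa using hx
  filter_upwards [h.ae_logRatio_eq_sum hα, ae_all_iff.2 hz] with x h1 h2
  rw [h1, Finset.sum_eq_zero fun j _ => h2 j]

theorem sq_sqrt_mul_sigmaBar (h : IsTestingPair μ φ₀ φ₁) {α : ℝ}
    (hα : IsChernoffPoint (Measure.pi μ) (prodDensity φ₀) (prodDensity φ₁) α) :
    0 < sigmaBar μ φ₀ φ₁ α ∧ 0 < √(n : ℝ) ∧
      ∑ j, varZ (μ j) (φ₀ j) (φ₁ j) α = n * sigmaBar μ φ₀ φ₁ α ^ 2 := by
  have h1 := h.sum_varZ_pos hα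
  have hn : 0 < (n : ℝ) := by
    rcases Nat.eq_zero_or_pos n with rfl | hn
    · simp at h1
    · exact_mod_cast hn
  have h2 : 0 < 1 / (n : ℝ) * ∑ j, varZ (μ j) (φ₀ j) (φ₁ j) α := by positivity
  refine ⟨Real.sqrt_pos.2 h2, Real.sqrt_pos.2 hn, ?_⟩
  rw [sigmaBar, Real.sq_sqrt h2.le]
  field_simp

end IsTestingPair

end Product

/-! ### Exponential families. -/

theorem hessianForm_eq_fderiv_fderiv {d : ℕ} (A : EuclideanSpace ℝ (Fin d) → ℝ)
    (θ v : EuclideanSpace ℝ (Fin d)) : hessianForm A θ v = fderiv ℝ (fderiv ℝ A) θ v v := by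
  have hv : ∑ i, v i • EuclideanSpace.single i (1 : ℝ) = v := by
    simpa using (EuclideanSpace.basisFun (Fin d) ℝ).sum_repr v
  have h : fderiv ℝ (fderiv ℝ A) θ v v = fderiv ℝ (fderiv ℝ A) θ
      (∑ i, v i • EuclideanSpace.single i (1 : ℝ)) (∑ i, v i • EuclideanSpace.single i (1 : ℝ)) := by
    rw [hv]
  rw [h]
  simp only [hessianForm, dotProduct, Matrix.mulVec, hessianMatrix, Matrix.of_apply,
    iteratedFDeriv_two_apply, Matrix.cons_val_zero, Matrix.cons_val_one, map_sum, map_smul,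
    _root_.sum_apply, _root_.smul_apply, smul_eq_mul]
  simp only [Finset.mul_sum]
  rw [Finset.sum_comm]
  refine Finset.sum_congr rfl fun i _ => Finset.sum_congr rfl fun k _ => ?_
  ring

theorem iteratedDeriv_two_comp_segment {E : Type*} [NormedAddCommGroup E] [NormedSpace ℝ E]
    {A : E → ℝ} {θ₀ θ₁ : E} {α : ℝ} (hA : ContDiffAt ℝ ∞ A ((1 - α) • θ₀ + α • θ₁)) (c₀ c₁ : ℝ) :
    iteratedDeriv 2 (fun β : ℝ => A ((1 - β) • θ₀ + β • θ₁) - ((1 - β) * c₀ + β * c₁)) α =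
      fderiv ℝ (fderiv ℝ A) ((1 - α) • θ₀ + α • θ₁) (θ₁ - θ₀) (θ₁ - θ₀) := by
  have hline : ∀ β : ℝ, HasDerivAt (fun β : ℝ => (1 - β) • θ₀ + β • θ₁) (θ₁ - θ₀) β := fun β => by
    have h1 := (((hasDerivAt_id β).const_sub 1).smul_const θ₀).add
      ((hasDerivAt_id β).smul_const θ₁)
    refine h1.congr_deriv ?_
    simp [sub_eq_neg_add]
  have haff : ∀ β : ℝ, HasDerivAt (fun β : ℝ => (1 - β) * c₀ + β * c₁) (c₁ - c₀) β := fun β => by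
    have h1 := (((hasDerivAt_id β).const_sub 1).mul_const c₀).add
      ((hasDerivAt_id β).mul_const c₁)
    refine h1.congr_deriv ?_
    ring
  -- Smoothness is given at one point only, but being continuously differentiable at a point is an
  -- open condition, so the first derivative can be computed near `α`.
  have hev : ∀ᶠ β in nhds α, DifferentiableAt ℝ A ((1 - β) • θ₀ + β • θ₁) := by
    have h1 : ∀ᶠ θ in nhds ((1 - α) • θ₀ + α • θ₁), ContDiffAt ℝ 1 A θ :=
      (hA.of_le (by exact_mod_cast le_top)).eventually (by simp)
    exact ((hline α).continuousAt.eventually h1).mono fun β hβ => hβ.differentiableAt (by simp)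
  have hd : deriv (fun β : ℝ => A ((1 - β) • θ₀ + β • θ₁) - ((1 - β) * c₀ + β * c₁)) =ᶠ[nhds α]
      fun β => fderiv ℝ A ((1 - β) • θ₀ + β • θ₁) (θ₁ - θ₀) - (c₁ - c₀) :=
    hev.mono fun β hβ => ((hβ.hasFDerivAt.comp_hasDerivAt β (hline β)).sub (haff β)).deriv
  rw [iteratedDeriv_succ, iteratedDeriv_one, hd.deriv_eq]
  have h2 : DifferentiableAt ℝ (fderiv ℝ A) ((1 - α) • θ₀ + α • θ₁) :=
    (hA.fderiv_right (m := ∞) (by simp)).differentiableAt (by simp)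
  have h3 : HasDerivAt (fun β : ℝ => fderiv ℝ A ((1 - β) • θ₀ + β • θ₁))
      (fderiv ℝ (fderiv ℝ A) ((1 - α) • θ₀ + α • θ₁) (θ₁ - θ₀)) α :=
    h2.hasFDerivAt.comp_hasDerivAt α (hline α)
  have h4 : HasDerivAt (fun β : ℝ => fderiv ℝ A ((1 - β) • θ₀ + β • θ₁) (θ₁ - θ₀))
      (fderiv ℝ (fderiv ℝ A) ((1 - α) • θ₀ + α • θ₁) (θ₁ - θ₀) (θ₁ - θ₀)) α :=
    ((ContinuousLinearMap.apply ℝ ℝ (θ₁ - θ₀)).hasFDerivAt).comp_hasDerivAt α h3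
  exact (h4.sub_const (c₁ - c₀)).deriv

namespace ExponentialFamily

variable {X : Type u} [MeasurableSpace X] {ν : Measure X} {d : ℕ} (E : ExponentialFamily ν d)
  {θ₀ θ₁ : EuclideanSpace ℝ (Fin d)}

theorem segment_mem (h₀ : θ₀ ∈ E.Θ) (h₁ : θ₁ ∈ E.Θ) {α : ℝ} (hα : α ∈ Set.Ioo (0 : ℝ) 1) :
    (1 - α) • θ₀ + α • θ₁ ∈ E.Θ :=
  E.convex_Θ h₀ h₁ (by linarith [hα.2]) hα.1.le (by ring)

/-- The exponent is linear in the parameter apart from `A`, so interpolating densities geometrically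
interpolates parameters; only the normalization changes. -/
theorem geomMean_pdf (α : ℝ) (x : X) :
    geomMean (E.pdf θ₀) (E.pdf θ₁) α x = E.pdf ((1 - α) • θ₀ + α • θ₁) x *
      Real.exp (E.A ((1 - α) • θ₀ + α • θ₁) - ((1 - α) * E.A θ₀ + α * E.A θ₁)) := by
  rcases (E.h_nonneg x).eq_or_lt with h | h
  · have h1 : ∀ θ, E.pdf θ x = 0 := fun θ => by rw [pdf, ← h, zero_mul]
    rw [geomMean_self (by rw [h1, h1]) (by rw [h1]), h1, h1, zero_mul]
  · have h1 : ∀ θ, 0 < E.pdf θ x := fun θ => mul_pos h (Real.exp_pos _)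
    rw [geomMean_of_pos (h1 _) (h1 _), logRatio, Real.log_div (h1 _).ne' (h1 _).ne']
    simp only [pdf]
    rw [Real.log_mul h.ne' (Real.exp_ne_zero _), Real.log_mul h.ne' (Real.exp_ne_zero _),
      Real.log_exp, Real.log_exp, mul_assoc, mul_assoc, ← Real.exp_add, ← Real.exp_add,
      inner_add_left, real_inner_smul_left, real_inner_smul_left]
    ring_nf

theorem log_integral_geomMean_pdf (h₀ : θ₀ ∈ E.Θ) (h₁ : θ₁ ∈ E.Θ) {α : ℝ}
    (hα : α ∈ Set.Ioo (0 : ℝ) 1) :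
    Real.log (∫ x, geomMean (E.pdf θ₀) (E.pdf θ₁) α x ∂ν) =
      E.A ((1 - α) • θ₀ + α • θ₁) - ((1 - α) * E.A θ₀ + α * E.A θ₁) := by
  simp_rw [E.geomMean_pdf]
  rw [integral_mul_const]
  unfold pdf
  rw [E.integral_eq_one _ (E.segment_mem h₀ h₁ hα), one_mul, Real.log_exp]

theorem chernoffDiv_pdf (h₀ : θ₀ ∈ E.Θ) (h₁ : θ₁ ∈ E.Θ) {α : ℝ} (hα : α ∈ Set.Ioo (0 : ℝ) 1) :
    chernoffDiv ν (E.pdf θ₀) (E.pdf θ₁) α =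
      (1 - α) * E.A θ₀ + α * E.A θ₁ - E.A ((1 - α) • θ₀ + α • θ₁) := by
  have := E.log_integral_geomMean_pdf h₀ h₁ hα
  change -Real.log (∫ x, geomMean (E.pdf θ₀) (E.pdf θ₁) α x ∂ν) = _
  rw [this]; ring

theorem isDensity_pdf {θ : EuclideanSpace ℝ (Fin d)} (h : θ ∈ E.Θ) : IsDensity ν (E.pdf θ) where
  measurable := by
    have h1 := E.measurable_T
    have h2 := E.measurable_h
    unfold pdf
    fun_prop
  nonneg x := mul_nonneg (E.h_nonneg x) (Real.exp_pos _).le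
  integral_eq_one := E.integral_eq_one θ h

theorem varZ_pdf (h₀ : θ₀ ∈ E.Θ) (h₁ : θ₁ ∈ E.Θ) {α : ℝ} (hα : α ∈ Set.Ioo (0 : ℝ) 1) :
    varZ ν (E.pdf θ₀) (E.pdf θ₁) α =
      hessianForm E.A ((1 - α) • θ₀ + α • θ₁) (θ₀ - θ₁) := by
  have hpos : 0 < ∫ x, geomMean (E.pdf θ₀) (E.pdf θ₁) α x ∂ν := by
    simp_rw [E.geomMean_pdf]
    rw [integral_mul_const, (E.isDensity_pdf (E.segment_mem h₀ h₁ hα)).integral_eq_one, one_mul]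
    exact Real.exp_pos _
  rw [varZ_eq_variance (E.isDensity_pdf h₀) (E.isDensity_pdf h₁) hα hpos]
  have hev : (fun β => Real.log (∫ x, geomMean (E.pdf θ₀) (E.pdf θ₁) β x ∂ν)) =ᶠ[nhds α]
      fun β => E.A ((1 - β) • θ₀ + β • θ₁) - ((1 - β) * E.A θ₀ + β * E.A θ₁) :=
    Filter.eventually_of_mem (Ioo_mem_nhds hα.1 hα.2) fun β hβ =>
      E.log_integral_geomMean_pdf h₀ h₁ hβ
  rw [hev.iteratedDeriv_eq, iteratedDeriv_two_comp_segment
    (E.smooth_A _ (E.segment_mem h₀ h₁ hα)), hessianForm_eq_fderiv_fderiv,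
    ← neg_sub θ₁ θ₀]
  simp only [map_neg, _root_.neg_apply, neg_neg]

end ExponentialFamily

/-! ### Assembly of the main theorem. -/

theorem mainTheorem3 (C₁ : ℝ) :
    ∃ C₂ C₃ C₄ : ℝ, 0 < C₂ ∧ 0 < C₃ ∧ 0 < C₄ ∧
      ∀ (n : ℕ) (Ω : Fin n → Type u) [∀ j, MeasurableSpace (Ω j)]
        (μ : ∀ j, Measure (Ω j)) [∀ j, SigmaFinite (μ j)] (φ₀ φ₁ : ∀ j, Ω j → ℝ),
        IsTestingPair μ φ₀ φ₁ →
        (∃! α : ℝ, IsChernoffPoint (Measure.pi μ) (prodDensity φ₀) (prodDensity φ₁) α) ∧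
        ∀ α : ℝ, IsChernoffPoint (Measure.pi μ) (prodDensity φ₀) (prodDensity φ₁) α →
          0 < sigmaBar μ φ₀ φ₁ α ∧
          -- the bounds for general densities, which are to hold with the same constants
          (∑ j, absThirdMomentZ (μ j) (φ₀ j) (φ₁ j) α ≤ C₁ * n * sigmaBar μ φ₀ φ₁ α ^ 2 →
            expectG (Measure.pi μ) (prodDensity φ₀) (prodDensity φ₁) α ≤
              C₂ / (Real.sqrt n * sigmaBar μ φ₀ φ₁ α * (1 - α) * α) ∧
            affinity (Measure.pi μ) (prodDensity φ₀) (prodDensity φ₁) ≤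
              C₂ / (Real.sqrt n * sigmaBar μ φ₀ φ₁ α * (1 - α) * α) *
                Real.exp (-chernoffDiv (Measure.pi μ) (prodDensity φ₀) (prodDensity φ₁) α) ∧
            (C₃ ≤ Real.sqrt n * sigmaBar μ φ₀ φ₁ α * (1 - α) * α →
              C₄ / (Real.sqrt n * sigmaBar μ φ₀ φ₁ α * (1 - α) * α) ≤
                expectG (Measure.pi μ) (prodDensity φ₀) (prodDensity φ₁) α ∧
              C₄ / (Real.sqrt n * sigmaBar μ φ₀ φ₁ α * (1 - α) * α) *
                  Real.exp (-chernoffDiv (Measure.pi μ) (prodDensity φ₀) (prodDensity φ₁) α) ≤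
                affinity (Measure.pi μ) (prodDensity φ₀) (prodDensity φ₁))) ∧
          -- the case of exponential families
          ∀ (d : ℕ) (E : ∀ j, ExponentialFamily (μ j) d)
            (θ₀ θ₁ : Fin n → EuclideanSpace ℝ (Fin d)),
            (∀ j, θ₀ j ∈ (E j).Θ ∧ θ₁ j ∈ (E j).Θ) →
            (∀ j, φ₀ j = (E j).pdf (θ₀ j) ∧ φ₁ j = (E j).pdf (θ₁ j)) →
            (∀ j, varZ (μ j) (φ₀ j) (φ₁ j) α =
              hessianForm (E j).A ((1 - α) • θ₀ j + α • θ₁ j) (θ₀ j - θ₁ j)) ∧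
            sigmaBar μ φ₀ φ₁ α ^ 2 =
              (1 / (n : ℝ)) *
                ∑ j, hessianForm (E j).A ((1 - α) • θ₀ j + α • θ₁ j) (θ₀ j - θ₁ j) ∧
            chernoffDiv (Measure.pi μ) (prodDensity φ₀) (prodDensity φ₁) α =
              ∑ j, ((1 - α) * (E j).A (θ₀ j) + α * (E j).A (θ₁ j)
                - (E j).A ((1 - α) • θ₀ j + α • θ₁ j)) ∧
            (∑ j, absThirdMomentZ (μ j) (φ₀ j) (φ₁ j) α ≤ C₁ * n * sigmaBar μ φ₀ φ₁ α ^ 2 →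
              affinity (Measure.pi μ) (prodDensity φ₀) (prodDensity φ₁) ≤
                C₂ / (Real.sqrt n * sigmaBar μ φ₀ φ₁ α * (1 - α) * α) *
                  Real.exp (-∑ j, ((1 - α) * (E j).A (θ₀ j) + α * (E j).A (θ₁ j)
                    - (E j).A ((1 - α) • θ₀ j + α • θ₁ j))) ∧
              (C₃ ≤ Real.sqrt n * sigmaBar μ φ₀ φ₁ α * (1 - α) * α →
                C₄ / (Real.sqrt n * sigmaBar μ φ₀ φ₁ α * (1 - α) * α) *
                    Real.exp (-∑ j, ((1 - α) * (E j).A (θ₀ j) + α * (E j).A (θ₁ j)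
                      - (E j).A ((1 - α) • θ₀ j + α • θ₁ j))) ≤
                  affinity (Measure.pi μ) (prodDensity φ₀) (prodDensity φ₁))) := by
  obtain ⟨C₂, C₃, C₄, hC₂, hC₃, hC₄, hbounds⟩ := exists_bounds_integral_gFun C₁
  refine ⟨C₂, C₃, C₄, hC₂, hC₃, hC₄, ?_⟩
  intro n Ω _ μ _ φ₀ φ₁ h
  refine ⟨existsUnique_isChernoffPoint h.isDensity_zero h.isDensity_one h.ae_pos_iff h.not_ae_eq,
    fun α hα => ?_⟩
  obtain ⟨hσ, hn, hvar⟩ := h.sq_sqrt_mul_sigmaBar hα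
  have haff := affinity_eq h.isDensity_zero h.isDensity_one hα.1
  have hmain : ∑ j, absThirdMomentZ (μ j) (φ₀ j) (φ₁ j) α ≤ C₁ * n * sigmaBar μ φ₀ φ₁ α ^ 2 →
      expectG (Measure.pi μ) (prodDensity φ₀) (prodDensity φ₁) α ≤
        C₂ / (Real.sqrt n * sigmaBar μ φ₀ φ₁ α * (1 - α) * α) ∧
      (C₃ ≤ Real.sqrt n * sigmaBar μ φ₀ φ₁ α * (1 - α) * α →
        C₄ / (Real.sqrt n * sigmaBar μ φ₀ φ₁ α * (1 - α) * α) ≤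
          expectG (Measure.pi μ) (prodDensity φ₀) (prodDensity φ₁) α) := by
    intro h3
    have hQ : IsProbabilityMeasure
        (chernoffMeasure (Measure.pi μ) (prodDensity φ₀) (prodDensity φ₁) α) := by
      have := h.isProbabilityMeasure_chernoffMeasure hα.1
      rw [h.chernoffMeasure_pi hα.1]; infer_instance
    have hr : (Real.sqrt n * sigmaBar μ φ₀ φ₁ α) ^ 2 = n * sigmaBar μ φ₀ φ₁ α ^ 2 := by
      rw [mul_pow, Real.sq_sqrt (Nat.cast_nonneg n)]
    -- The standard deviation of the log-ratio is `r = √n * sigmaBar`, so the third-moment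
    -- hypothesis is exactly the one required of the centered sum.
    have hb := hbounds (chernoffMeasure (Measure.pi μ) (prodDensity φ₀) (prodDensity φ₁) α) _
      (Real.sqrt n * sigmaBar μ φ₀ φ₁ α) α (h.isCenteredFamily hα.1) (mul_pos hn hσ) hα.1
      (by simp_rw [h.integral_sq_eq_varZ hα.1]; rw [hvar, hr])
      (by simp_rw [h.integral_abs_cube_eq_absThirdMomentZ hα.1]; rw [hr, ← mul_assoc]; exact h3)
    have hE : expectG (Measure.pi μ) (prodDensity φ₀) (prodDensity φ₁) α =
        ∫ x, gFun α (∑ j, centeredLogRatio (μ j) (φ₀ j) (φ₁ j) α (x j))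
          ∂(chernoffMeasure (Measure.pi μ) (prodDensity φ₀) (prodDensity φ₁) α) :=
      integral_congr_ae ((h.ae_logRatio_eq_sum hα).mono fun x hx => by simp only [hx])
    rwa [hE]
  have hup : ∑ j, absThirdMomentZ (μ j) (φ₀ j) (φ₁ j) α ≤ C₁ * n * sigmaBar μ φ₀ φ₁ α ^ 2 →
      affinity (Measure.pi μ) (prodDensity φ₀) (prodDensity φ₁) ≤
        C₂ / (Real.sqrt n * sigmaBar μ φ₀ φ₁ α * (1 - α) * α) *
          Real.exp (-chernoffDiv (Measure.pi μ) (prodDensity φ₀) (prodDensity φ₁) α) ∧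
      (C₃ ≤ Real.sqrt n * sigmaBar μ φ₀ φ₁ α * (1 - α) * α →
        C₄ / (Real.sqrt n * sigmaBar μ φ₀ φ₁ α * (1 - α) * α) *
          Real.exp (-chernoffDiv (Measure.pi μ) (prodDensity φ₀) (prodDensity φ₁) α) ≤
        affinity (Measure.pi μ) (prodDensity φ₀) (prodDensity φ₁)) := by
    intro h3
    rw [haff]
    exact ⟨mul_le_mul_of_nonneg_right (hmain h3).1 (Real.exp_pos _).le,
      fun hC => mul_le_mul_of_nonneg_right ((hmain h3).2 hC) (Real.exp_pos _).le⟩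
  refine ⟨hσ, fun h3 => ⟨(hmain h3).1, (hup h3).1, fun hC => ⟨(hmain h3).2 hC, (hup h3).2 hC⟩⟩,
    fun d E θ₀ θ₁ hθ hφ => ?_⟩
  have hvarE : ∀ j, varZ (μ j) (φ₀ j) (φ₁ j) α =
      hessianForm (E j).A ((1 - α) • θ₀ j + α • θ₁ j) (θ₀ j - θ₁ j) := fun j => by
    rw [(hφ j).1, (hφ j).2, (E j).varZ_pdf (hθ j).1 (hθ j).2 hα.1]
  have hC : chernoffDiv (Measure.pi μ) (prodDensity φ₀) (prodDensity φ₁) α =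
      ∑ j, ((1 - α) * (E j).A (θ₀ j) + α * (E j).A (θ₁ j)
        - (E j).A ((1 - α) • θ₀ j + α • θ₁ j)) := by
    rw [h.chernoffDiv_eq_sum hα.1]
    refine Finset.sum_congr rfl fun j _ => ?_
    rw [(hφ j).1, (hφ j).2, (E j).chernoffDiv_pdf (hθ j).1 (hθ j).2 hα.1]
  refine ⟨hvarE, ?_, hC, fun h3 => ?_⟩
  · have hn0 : (n : ℝ) ≠ 0 := (Real.sqrt_pos.1 hn).ne'
    rw [← Finset.sum_congr rfl fun j _ => hvarE j, hvar]
    field_simp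
  · rw [← hC]
    exact hup h3
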